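/- Let $K$ be a field of characteristic different from $2$. Let $\mathrm{qgr}\,\widetilde{\mathrm{Alt}^!}$ be the symmetric operad over $K$ (without operations of arity $0$) generated by a symmetric binary operation $a_1,a_2\mapsto a_1\cdot a_2$ and a skew-symmetric binary operation $a_1,a_2\mapsto[a_1,a_2]$ subject to the relations $$[[a_1,a_2],a_3]+[[a_1,a_3],a_2]=0,$$ $$[a_1\cdot a_2,a_3]=a_1\cdot[a_2,a_3]+[a_1,a_3]\cdot a_2,$$ $$(a_1\cdot a_2)\cdot a_3=a_1\cdot(a_2\cdot a_3).$$ For every $n\ge 1$, the $S_n$-module $\mathrm{qgr}\,\widetilde{\mathrm{Alt}^!}(n)$, on which $S_n$ acts by permutations of arguments, is isomorphic to the direct sum $$\bigoplus_{k}\mathrm{Ind}_{S_k\times S_{n-k}}^{S_n}(\mathbf 1_k\otimes\mathrm{sgn}_{n-k}),$$ where $k$ runs over the integers with $0\le k\le n-2$ and $k=n$, each such $k$ occurring exactly once; here $\mathbf 1_k$ and $\mathrm{sgn}_{n-k}$ are the trivial representation of $S_k$ and the sign representation of $S_{n-k}$ over $K$, and $S_k\times S_{n-k}\subset S_n$ is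 the subgroup where the two factors permute the first $k$ and the last $n-k$ elements of $\{1,\dots,n\}$. -/

import Mathlib

/-! ### Tree monomials in a product and a bracket -/

/-- Rooted planar binary trees whose internal vertices are labelled by one of two binary
operations, the product `a · b` (`dot`) or the bracket `[a, b]` (`br`), and whose leaves are
labelled by elements of `X`. -/
inductive OpTree (X : Type) : Type
  | leaf : X → OpTree X
  | dot : OpTree X → OpTree X → OpTree X
  | br : OpTree X → OpTree X → OpTree X

namespace OpTree

/-- The list of leaf labels, from left to right. -/
def leaves {X : Type} : OpTree X → List X
  | leaf x => [x]
  | dot s t => s.leaves ++ t.leaves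
  | br s t => s.leaves ++ t.leaves

/-- Grafting: replace every leaf labelled `x` by the tree `f x`. -/
def graft {X Y : Type} (f : X → OpTree Y) : OpTree X → OpTree Y
  | leaf x => f x
  | dot s t => dot (s.graft f) (t.graft f)
  | br s t => br (s.graft f) (t.graft f)

/-- Relabelling of the leaves. -/
def relabel {X Y : Type} (f : X → Y) : OpTree X → OpTree Y :=
  graft fun x => leaf (f x)

theorem leaves_graft {X Y : Type} (f : X → OpTree Y) (t : OpTree X) :
    (t.graft f).leaves = t.leaves.flatMap fun x => (f x).leaves := by
  induction t with
  | leaf x => simp [graft, leaves]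
  | dot s t hs ht => simp [graft, leaves, hs, ht]
  | br s t hs ht => simp [graft, leaves, hs, ht]

theorem leaves_relabel {X Y : Type} (f : X → Y) (t : OpTree X) :
    (t.relabel f).leaves = t.leaves.map f := by
  induction t with
  | leaf x => rfl
  | dot s t hs ht => simpa [relabel, graft, leaves] using congrArg₂ (· ++ ·) hs ht
  | br s t hs ht => simpa [relabel, graft, leaves] using congrArg₂ (· ++ ·) hs ht

theorem relabel_id {X : Type} (t : OpTree X) : t.relabel id = t := by
  induction t with
  | leaf x => rfl
  | dot s t hs ht => exact congrArg₂ dot hs ht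
  | br s t hs ht => exact congrArg₂ br hs ht

theorem relabel_comp {X Y Z : Type} (g : Y → Z) (f : X → Y) (t : OpTree X) :
    t.relabel (g ∘ f) = (t.relabel f).relabel g := by
  induction t with
  | leaf x => rfl
  | dot s t hs ht => exact congrArg₂ dot hs ht
  | br s t hs ht => exact congrArg₂ br hs ht

end OpTree

/-- Tree monomials of arity `n`: the leaves are labelled bijectively by `Fin n`. -/
def TreeMonomial (n : ℕ) : Type :=
  {t : OpTree (Fin n) // t.leaves.Nodup ∧ ∀ i, i ∈ t.leaves}

namespace TreeMonomial

/-- The symmetric group acts on tree monomials by permuting the arguments. -/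
def perm {n : ℕ} (σ : Equiv.Perm (Fin n)) (t : TreeMonomial n) : TreeMonomial n :=
  ⟨t.1.relabel σ, by
    rw [OpTree.leaves_relabel]
    refine ⟨t.2.1.map σ.injective, fun i => ?_⟩
    exact List.mem_map.2 ⟨σ.symm i, t.2.2 _, by simp⟩⟩

/-- The operadic composition `γ(t; s₁, …, sₘ)` of tree monomials: the root of `s i` is grafted
onto the `i`-th leaf of `t`, and the arguments of `s₁, …, sₘ` become consecutive blocks of
arguments of the result. -/
def comp {m : ℕ} {k : Fin m → ℕ} (t : TreeMonomial m) (s : ∀ i, TreeMonomial (k i)) :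
    TreeMonomial (∑ i, k i) :=
  ⟨t.1.graft fun i => (s i).1.relabel fun j => finSigmaFinEquiv ⟨i, j⟩, by
    rw [OpTree.leaves_graft]
    simp only [OpTree.leaves_relabel]
    refine ⟨List.nodup_flatMap.2 ⟨fun i _ => (s i).2.1.map fun a b h => ?_, ?_⟩, fun x => ?_⟩
    · simpa using h
    · refine t.2.1.imp fun {a b} hab => ?_
      intro x hx hy
      obtain ⟨u, -, rfl⟩ := List.mem_map.1 hx
      obtain ⟨v, -, hv⟩ := List.mem_map.1 hy
      exact hab (congrArg Sigma.fst (finSigmaFinEquiv.injective hv)).symm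
    · obtain ⟨⟨i, j⟩, rfl⟩ := finSigmaFinEquiv.surjective x
      exact List.mem_flatMap.2 ⟨i, t.2.2 i, List.mem_map.2 ⟨j, (s i).2.2 j, rfl⟩⟩⟩

end TreeMonomial

/-! ### The free operad on two binary operations and its ideals -/

/-- Arity `n` component of the free symmetric operad over `K` on two binary operations (without
any symmetry): the vector space spanned by the tree monomials of arity `n`. -/
abbrev FreeOperad (K : Type*) [Field K] (n : ℕ) : Type _ := TreeMonomial n →₀ K

namespace FreeOperad

variable (K : Type*) [Field K]

/-- The action of `S_n` on the component of arity `n`, by permutations of arguments. -/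
noncomputable def permRep (n : ℕ) : Representation K (Equiv.Perm (Fin n)) (FreeOperad K n) where
  toFun σ := Finsupp.lmapDomain K K (TreeMonomial.perm σ)
  map_one' := by
    have h : TreeMonomial.perm (1 : Equiv.Perm (Fin n)) = id :=
      funext fun t => Subtype.ext (OpTree.relabel_id t.1)
    rw [h]
    exact Finsupp.lmapDomain_id K K
  map_mul' σ τ := by
    have h : TreeMonomial.perm (σ * τ) = TreeMonomial.perm σ ∘ TreeMonomial.perm τ :=
      funext fun t => Subtype.ext (OpTree.relabel_comp σ τ t.1)
    rw [h]
    exact Finsupp.lmapDomain_comp K K _ _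

variable {K}

/-- The operadic composition `γ(f; g₁, …, gₘ)`: the multilinear extension of the composition of
tree monomials. -/
noncomputable def comp {m : ℕ} {k : Fin m → ℕ} (f : FreeOperad K m)
    (g : ∀ i, FreeOperad K (k i)) : FreeOperad K (∑ i, k i) :=
  ∑ t ∈ f.support, ∑ s ∈ Fintype.piFinset fun i => (g i).support,
    Finsupp.single (t.comp s) (f t * ∏ i, g i (s i))

variable (K) in
/-- Operadic ideals: families of subspaces, stable under the symmetric groups, such that a
composition belongs to the family as soon as one of the composed elements does. -/
structure IsIdeal (I : ∀ n, Submodule K (FreeOperad K n)) : Prop where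
  perm_mem : ∀ (n : ℕ) (σ : Equiv.Perm (Fin n)) (f : FreeOperad K n),
    f ∈ I n → permRep K n σ f ∈ I n
  comp_mem_left : ∀ (m : ℕ) (k : Fin m → ℕ) (f : FreeOperad K m) (g : ∀ i, FreeOperad K (k i)),
    f ∈ I m → comp f g ∈ I (∑ i, k i)
  comp_mem_right : ∀ (m : ℕ) (k : Fin m → ℕ) (f : FreeOperad K m) (g : ∀ i, FreeOperad K (k i)),
    (∃ i, g i ∈ I (k i)) → comp f g ∈ I (∑ i, k i)

/-- Arity `n` component of the operadic ideal generated by a collection `R` of relations, that is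
of the smallest operadic ideal containing `R`. -/
noncomputable def idealSpan (R : ∀ n, Set (FreeOperad K n)) (n : ℕ) : Submodule K (FreeOperad K n) :=
  sInf {J | ∃ I : ∀ m, Submodule K (FreeOperad K m),
    IsIdeal K I ∧ (∀ m, R m ⊆ I m) ∧ J = I n}

theorem idealSpan_perm_stable (R : ∀ n, Set (FreeOperad K n)) (n : ℕ)
    (σ : Equiv.Perm (Fin n)) :
    idealSpan R n ≤ (idealSpan R n).comap (permRep K n σ) := by
  intro f hf
  simp only [idealSpan, Submodule.mem_comap, Submodule.mem_sInf] at hf ⊢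
  rintro J ⟨I, hI, hR, rfl⟩
  exact hI.perm_mem n σ f (hf _ ⟨I, hI, hR, rfl⟩)

end FreeOperad

/-! ### The operad `qgr` of the modified dual alternative operad -/

namespace QgrAlt

variable (K : Type*) [Field K]

open OpTree

/-- The element of the free operad given by a single tree monomial. -/
noncomputable def mon {n : ℕ} (t : OpTree (Fin n))
    (ht : t.leaves.Nodup ∧ ∀ i, i ∈ t.leaves) : FreeOperad K n :=
  Finsupp.single (⟨t, ht⟩ : TreeMonomial n) 1

/-- `a₁ · a₂ - a₂ · a₁`: the product is symmetric. -/
noncomputable def symmRel : FreeOperad K 2 :=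
  mon K (dot (leaf 0) (leaf 1)) (by decide) - mon K (dot (leaf 1) (leaf 0)) (by decide)

/-- `[a₁, a₂] + [a₂, a₁]`: the bracket is skew-symmetric. -/
noncomputable def skewRel : FreeOperad K 2 :=
  mon K (br (leaf 0) (leaf 1)) (by decide) + mon K (br (leaf 1) (leaf 0)) (by decide)

/-- `[[a₁, a₂], a₃] + [[a₁, a₃], a₂]`. -/
noncomputable def bracketRel : FreeOperad K 3 :=
  mon K (br (br (leaf 0) (leaf 1)) (leaf 2)) (by decide) +
    mon K (br (br (leaf 0) (leaf 2)) (leaf 1)) (by decide)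

/-- `[a₁ · a₂, a₃] - (a₁ · [a₂, a₃] + [a₁, a₃] · a₂)`. -/
noncomputable def leibnizRel : FreeOperad K 3 :=
  mon K (br (dot (leaf 0) (leaf 1)) (leaf 2)) (by decide) -
    (mon K (dot (leaf 0) (br (leaf 1) (leaf 2))) (by decide) +
      mon K (dot (br (leaf 0) (leaf 2)) (leaf 1)) (by decide))

/-- `(a₁ · a₂) · a₃ - a₁ · (a₂ · a₃)`. -/
noncomputable def assocRel : FreeOperad K 3 :=
  mon K (dot (dot (leaf 0) (leaf 1)) (leaf 2)) (by decide) -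
    mon K (dot (leaf 0) (dot (leaf 1) (leaf 2))) (by decide)

/-- The defining relations. -/
inductive Relations : ∀ n, FreeOperad K n → Prop
  | symm : Relations 2 (symmRel K)
  | skew : Relations 2 (skewRel K)
  | bracket : Relations 3 (bracketRel K)
  | leibniz : Relations 3 (leibnizRel K)
  | assoc : Relations 3 (assocRel K)

/-- Arity `n` component of the operadic ideal generated by the defining relations. -/
noncomputable def ideal (n : ℕ) : Submodule K (FreeOperad K n) :=
  FreeOperad.idealSpan (fun m => {f | Relations K m f}) n

/-- Arity `n` component of the operad presented by a symmetric product, a skew-symmetric bracket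
and the relations above. -/
abbrev Component (n : ℕ) : Type _ := FreeOperad K n ⧸ ideal K n

/-- The `S_n`-module structure on the component of arity `n`. -/
noncomputable def rep (n : ℕ) : Representation K (Equiv.Perm (Fin n)) (Component K n) :=
  (FreeOperad.permRep K n).quotient (ideal K n) (FreeOperad.idealSpan_perm_stable _ n)

end QgrAlt

/-! ### The induced modules -/

/-- The one-dimensional representation `1_k ⊗ sgn_{n-k}` of the group `S_k × S_{n-k}`, where `S_k`
permutes the elements of `Fin n` smaller than `k` and `S_{n-k}` permutes the others:
`(σ, τ)` acts on `K` by multiplication by the sign of `τ`. -/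
noncomputable def trivTensorSgn (K : Type*) [Field K] (n k : ℕ) :
    Representation K
      (Equiv.Perm {i : Fin n // (i : ℕ) < k} × Equiv.Perm {i : Fin n // ¬ (i : ℕ) < k}) K where
  toFun g := (((Equiv.Perm.sign g.2 : ℤˣ) : ℤ) : K) • LinearMap.id
  map_one' := by ext; simp
  map_mul' g h := by ext; simp [mul_comm]

/-- `Ind_{S_k × S_{n-k}}^{S_n} (1_k ⊗ sgn_{n-k})`, for the standard embedding of `S_k × S_{n-k}`
in `S_n`. -/
noncomputable def indTrivSgn (K : Type*) [Field K] (n k : ℕ) :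
    Representation K (Equiv.Perm (Fin n))
      (Representation.IndV (Equiv.Perm.subtypeCongrHom fun i : Fin n => (i : ℕ) < k)
        (trivTensorSgn K n k)) :=
  Representation.ind (Equiv.Perm.subtypeCongrHom fun i : Fin n => (i : ℕ) < k)
    (trivTensorSgn K n k)

/-!
The component of arity `n` is the multilinear part of the free algebra on `n` generators. The proof
bounds it from above by finding spanning normal forms, and from below by an algebra in which these
normal forms take independent values.

*Upper bound.* Let `[,]` be the bracket of an algebra in characteristic other than two. The bracket
relation says that `[[a, b], c]` is totally skew-symmetric. Expanding `[[wx, y], z] = -[[wx, z], y]`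
by the Leibniz rule gives `[w, y] [x, z] = -[w, z] [x, y]`
(`QgrAlt.IsAlgebra.bracket_mul_bracket`), so that products of two brackets are totally
skew-symmetric too. A parity argument shows that brackets of depth three vanish
(`QgrAlt.IsAlgebra.bracket_bracket_bracket`), hence also `[[a, b], c] [[d, e], f] = 0`. It follows
that the product of the brackets `[aᵢ, aⱼ]` and of at most one `[[aᵢ, aⱼ], aₖ]` is, up to sign, a
totally skew-symmetric element `skewProd` that depends only on the set of its arguments, whose size
is any number other than one. By the Leibniz rule every value of a tree is a combination of the
normal forms `a₁ ⋯ aₖ · skewProd(aₖ₊₁, …, aₙ)` (`QgrAlt.IsAlgebra.evalB_mem_span_normalForm`).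

*Transfer to the operad.* These computations take place in the free algebra on `n` generators,
realized as the quotient of the span of all trees by `freeIdeal`: the trees with a repeated leaf and
all relabelled elements of the operadic ideal. That this is an ideal containing all values of
relations is what stability of operadic ideals under composition means, and by construction the
multilinear part of the quotient is the component of the operad (`QgrAlt.FreeAlg.toComponent`).

*Lower bound.* Give each generator `aᵢ` a basis vector `eᵢ` as its weight, let weights add up under
the product, and let the bracket of two elements of weights `u` and `v` be their product times
`u ∧ v`, of weight `u + v + e`, where `e` is one more basis vector. This is an algebra over the operad
with values in the even part of an exterior algebra (`QgrAlt.isAlgebra_weightBracket`):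
`[[a, b], c]` acquires the factor `e ∧ w ∧ u ∧ v`, which is skew-symmetric in `u`, `v`, `w`. The
normal forms with skew arguments in `S` take the value, up to sign, of the exterior product of the
`eᵢ` with `i ∈ S`, possibly multiplied by `e`, and these are linearly independent.

*Conclusion.* The normal form with skew arguments `k, …, n - 1` spans a copy of `1_k ⊗ sgn_{n-k}`
over `S_k × S_{n-k}` and defines an equivariant map from the induced module to the operad. Together
these maps are surjective by the upper bound. The direct sum of the induced modules is spanned by
one vector for each `k` and each subset of size `n - k`, and these have linearly independent images,
so the map is injective.
-/

/-! ### Evaluation of tree monomials in algebras -/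

namespace OpTree

/-- The value of a tree in a set with two binary operations `m` (for `dot`) and `b` (for `br`),
after substitution of `a x` for the leaves labelled `x`. -/
def eval {X : Type} {A : Type*} (m b : A → A → A) (a : X → A) : OpTree X → A
  | leaf x => a x
  | dot s t => m (s.eval m b a) (t.eval m b a)
  | br s t => b (s.eval m b a) (t.eval m b a)

variable {X Y : Type} {A B : Type*}

theorem eval_graft (m b : A → A → A) (a : Y → A) (f : X → OpTree Y) (t : OpTree X) :
    (t.graft f).eval m b a = t.eval m b fun x => (f x).eval m b a := by
  induction t with
  | leaf x => rfl
  | dot s t hs ht => exact congrArg₂ m hs ht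
  | br s t hs ht => exact congrArg₂ b hs ht

theorem eval_relabel (m b : A → A → A) (a : Y → A) (f : X → Y) (t : OpTree X) :
    (t.relabel f).eval m b a = t.eval m b (a ∘ f) :=
  eval_graft m b a _ t

theorem eval_congr {m b : A → A → A} {a a' : X → A} {t : OpTree X}
    (h : ∀ x ∈ t.leaves, a x = a' x) : t.eval m b a = t.eval m b a' := by
  induction t with
  | leaf x => exact h x (by simp [leaves])
  | dot s t hs ht =>
    simp only [leaves, List.mem_append] at h
    exact congrArg₂ m (hs fun x hx => h x (.inl hx)) (ht fun x hx => h x (.inr hx))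
  | br s t hs ht =>
    simp only [leaves, List.mem_append] at h
    exact congrArg₂ b (hs fun x hx => h x (.inl hx)) (ht fun x hx => h x (.inr hx))

theorem map_eval {m b : A → A → A} {m' b' : B → B → B} (φ : A → B)
    (hm : ∀ x y, φ (m x y) = m' (φ x) (φ y)) (hb : ∀ x y, φ (b x y) = b' (φ x) (φ y))
    (a : X → A) (t : OpTree X) : φ (t.eval m b a) = t.eval m' b' (φ ∘ a) := by
  induction t with
  | leaf x => rfl
  | dot s t hs ht => rw [eval, hm, hs, ht, eval]
  | br s t hs ht => rw [eval, hb, hs, ht, eval]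

theorem leaves_ne_nil (t : OpTree X) : t.leaves ≠ [] := by
  induction t with
  | leaf x => simp [leaves]
  | dot s t hs ht => simp [leaves, hs]
  | br s t hs ht => simp [leaves, hs]

theorem relabel_congr {f g : X → Y} {t : OpTree X} (h : ∀ x ∈ t.leaves, f x = g x) :
    t.relabel f = t.relabel g := by
  induction t with
  | leaf x => exact congrArg leaf (h x (by simp [leaves]))
  | dot s t hs ht =>
    simp only [leaves, List.mem_append] at h
    exact congrArg₂ dot (hs fun x hx => h x (.inl hx)) (ht fun x hx => h x (.inr hx))
  | br s t hs ht =>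
    simp only [leaves, List.mem_append] at h
    exact congrArg₂ br (hs fun x hx => h x (.inl hx)) (ht fun x hx => h x (.inr hx))

section Multilinear

variable {K : Type*} [Field K] [AddCommGroup A] [Module K A]
  (m b : A →ₗ[K] A →ₗ[K] A)

/-- The value of a tree under bilinear operations. -/
abbrev evalB (a : X → A) (t : OpTree X) : A :=
  t.eval (fun x y => m x y) (fun x y => b x y) a

theorem evalB_dot (a : X → A) (s t : OpTree X) :
    (dot s t).evalB m b a = m (s.evalB m b a) (t.evalB m b a) := rfl

variable {m b}

theorem evalB_update_of_notMem [DecidableEq X] (a : X → A) {i : X} {t : OpTree X}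
    (h : i ∉ t.leaves) (x : A) :
    t.evalB m b (Function.update a i x) = t.evalB m b a :=
  eval_congr fun y hy => Function.update_of_ne (by rintro rfl; exact h hy) _ _

theorem evalB_update_add [DecidableEq X] (a : X → A) {i : X} (x y : A) {t : OpTree X}
    (hn : t.leaves.Nodup) (hi : i ∈ t.leaves) :
    t.evalB m b (Function.update a i (x + y)) =
      t.evalB m b (Function.update a i x) + t.evalB m b (Function.update a i y) := by
  induction t with
  | leaf z =>
    obtain rfl : i = z := by simpa [leaves] using hi
    simp [evalB, eval]
  | dot s t hs ht =>
    rw [leaves, List.nodup_append'] at hn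
    rcases List.mem_append.1 hi with h | h
    · have h' := fun z => evalB_update_of_notMem (m := m) (b := b) a (hn.2.2 h) z
      simp only [evalB, eval] at *
      rw [hs hn.1 h, h', h', h', map_add, LinearMap.add_apply]
    · have h' := fun z => evalB_update_of_notMem (m := m) (b := b) a (fun h' => hn.2.2 h' h) z
      simp only [evalB, eval] at *
      rw [ht hn.2.1 h, h', h', h', map_add]
  | br s t hs ht =>
    rw [leaves, List.nodup_append'] at hn
    rcases List.mem_append.1 hi with h | h
    · have h' := fun z => evalB_update_of_notMem (m := m) (b := b) a (hn.2.2 h) z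
      simp only [evalB, eval] at *
      rw [hs hn.1 h, h', h', h', map_add, LinearMap.add_apply]
    · have h' := fun z => evalB_update_of_notMem (m := m) (b := b) a (fun h' => hn.2.2 h' h) z
      simp only [evalB, eval] at *
      rw [ht hn.2.1 h, h', h', h', map_add]

theorem evalB_update_smul [DecidableEq X] (a : X → A) {i : X} (c : K) (x : A) {t : OpTree X}
    (hn : t.leaves.Nodup) (hi : i ∈ t.leaves) :
    t.evalB m b (Function.update a i (c • x)) = c • t.evalB m b (Function.update a i x) := by
  induction t with
  | leaf z =>
    obtain rfl : i = z := by simpa [leaves] using hi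
    simp [evalB, eval]
  | dot s t hs ht =>
    rw [leaves, List.nodup_append'] at hn
    rcases List.mem_append.1 hi with h | h
    · have h' := fun z => evalB_update_of_notMem (m := m) (b := b) a (hn.2.2 h) z
      simp only [evalB, eval] at *
      rw [hs hn.1 h, h', h', map_smul, LinearMap.smul_apply]
    · have h' := fun z => evalB_update_of_notMem (m := m) (b := b) a (fun h' => hn.2.2 h' h) z
      simp only [evalB, eval] at *
      rw [ht hn.2.1 h, h', h', map_smul]
  | br s t hs ht =>
    rw [leaves, List.nodup_append'] at hn
    rcases List.mem_append.1 hi with h | h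
    · have h' := fun z => evalB_update_of_notMem (m := m) (b := b) a (hn.2.2 h) z
      simp only [evalB, eval] at *
      rw [hs hn.1 h, h', h', map_smul, LinearMap.smul_apply]
    · have h' := fun z => evalB_update_of_notMem (m := m) (b := b) a (fun h' => hn.2.2 h' h) z
      simp only [evalB, eval] at *
      rw [ht hn.2.1 h, h', h', map_smul]

end Multilinear

end OpTree

section EvalF

variable {K : Type*} [Field K] {A : Type*} [AddCommGroup A] [Module K A]
  (m b : A →ₗ[K] A →ₗ[K] A)

/-- A tree monomial of arity `n` defines a multilinear operation in `n` variables. -/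
def TreeMonomial.evalMultilinear {n : ℕ} (t : TreeMonomial n) :
    MultilinearMap K (fun _ : Fin n => A) A where
  toFun a := t.1.evalB m b a
  map_update_add' a i x y := by
    convert OpTree.evalB_update_add a x y t.2.1 (t.2.2 i)
  map_update_smul' a i c x := by
    convert OpTree.evalB_update_smul a c x t.2.1 (t.2.2 i)

namespace FreeOperad

/-- The value at `a` of an element of the free operad, acting on `A` as a multilinear operation. -/
noncomputable def eval {n : ℕ} (f : FreeOperad K n) : MultilinearMap K (fun _ : Fin n => A) A :=
  Finsupp.linearCombination K (fun t => t.evalMultilinear m b) f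

theorem eval_apply {n : ℕ} (f : FreeOperad K n) (a : Fin n → A) :
    eval m b f a = f.sum fun t c => c • t.1.evalB m b a := by
  simp only [eval, Finsupp.linearCombination_apply, Finsupp.sum, sum_apply, smul_apply]
  rfl

theorem eval_single {n : ℕ} (t : TreeMonomial n) (c : K) (a : Fin n → A) :
    eval m b (Finsupp.single t c) a = c • t.1.evalB m b a := by
  simp [eval_apply]

/-- Evaluation at a fixed tuple, as a linear map. -/
noncomputable def evalAt {n : ℕ} (a : Fin n → A) : FreeOperad K n →ₗ[K] A :=
  Finsupp.linearCombination K fun t => t.1.evalB m b a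

theorem evalAt_apply {n : ℕ} (a : Fin n → A) (f : FreeOperad K n) :
    evalAt m b a f = eval m b f a := by
  rw [eval_apply, evalAt, Finsupp.linearCombination_apply]

theorem eval_permRep {n : ℕ} (σ : Equiv.Perm (Fin n)) (f : FreeOperad K n) (a : Fin n → A) :
    eval m b (permRep K n σ f) a = eval m b f (a ∘ σ) := by
  rw [← evalAt_apply, ← evalAt_apply]
  refine LinearMap.congr_fun (f := evalAt m b a ∘ₗ permRep K n σ) ?_ f
  ext t
  simp only [LinearMap.comp_apply, Finsupp.lsingle_apply, permRep, MonoidHom.coe_mk, OneHom.coe_mk,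
    Finsupp.lmapDomain_apply, Finsupp.mapDomain_single, evalAt, Finsupp.linearCombination_single]
  exact congrArg _ (OpTree.eval_relabel _ _ a σ t.1)

/-- The operadic composition is substitution of operations. -/
theorem eval_comp {r : ℕ} {k : Fin r → ℕ} (f : FreeOperad K r) (g : ∀ i, FreeOperad K (k i))
    (a : Fin (∑ i, k i) → A) :
    eval m b (comp f g) a =
      eval m b f fun i => eval m b (g i) fun j => a (finSigmaFinEquiv ⟨i, j⟩) := by
  classical
  simp only [← evalAt_apply m b a, comp, map_sum]
  simp only [evalAt_apply, eval_single]
  conv_rhs => rw [eval_apply, Finsupp.sum]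
  refine Finset.sum_congr rfl fun t _ => ?_
  have h : t.1.evalB m b (fun i => eval m b (g i) fun j => a (finSigmaFinEquiv ⟨i, j⟩)) =
      t.evalMultilinear m b fun i => ∑ s ∈ (g i).support,
        g i s • s.1.evalB m b fun j => a (finSigmaFinEquiv ⟨i, j⟩) := by
    simp only [eval_apply]
    rfl
  rw [h, MultilinearMap.map_sum_finset, Finset.smul_sum]
  refine Finset.sum_congr rfl fun s _ => ?_
  rw [MultilinearMap.map_smul_univ, smul_smul]
  congr 1
  change OpTree.eval _ _ _ (OpTree.graft _ _) = _
  rw [OpTree.eval_graft]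
  simp only [OpTree.eval_relabel]
  rfl

/-- The identities satisfied by a pair of bilinear operations form an operadic ideal. -/
theorem isIdeal_identities :
    IsIdeal K fun n => LinearMap.ker
      (Finsupp.linearCombination K fun t : TreeMonomial n => t.evalMultilinear m b) where
  perm_mem n σ f hf := by
    refine MultilinearMap.ext fun a => ?_
    have h : eval m b f = 0 := hf
    exact (eval_permRep m b σ f a).trans (by rw [h]; rfl)
  comp_mem_left r k f g hf := by
    refine MultilinearMap.ext fun a => ?_
    have h : eval m b f = 0 := hf
    exact (eval_comp m b f g a).trans (by rw [h]; rfl)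
  comp_mem_right r k f g hg := by
    obtain ⟨i, hi⟩ := hg
    refine MultilinearMap.ext fun a => ?_
    have h : eval m b (g i) = 0 := hi
    exact (eval_comp m b f g a).trans (MultilinearMap.map_coord_zero _ i (by rw [h]; rfl))

theorem idealSpan_le {R : ∀ n, Set (FreeOperad K n)} {I : ∀ n, Submodule K (FreeOperad K n)}
    (hI : IsIdeal K I) (h : ∀ n, R n ⊆ I n) (n : ℕ) : idealSpan R n ≤ I n :=
  sInf_le ⟨I, hI, h, rfl⟩

theorem mem_idealSpan {R : ∀ n, Set (FreeOperad K n)} {n : ℕ} {f : FreeOperad K n} :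
    f ∈ idealSpan R n ↔ ∀ I : ∀ m, Submodule K (FreeOperad K m),
      IsIdeal K I → (∀ m, R m ⊆ I m) → f ∈ I n := by
  rw [idealSpan, Submodule.mem_sInf]
  exact ⟨fun h I hI hR => h _ ⟨I, hI, hR, rfl⟩, by rintro h _ ⟨I, hI, hR, rfl⟩; exact h I hI hR⟩

theorem subset_idealSpan (R : ∀ n, Set (FreeOperad K n)) (n : ℕ) : R n ⊆ idealSpan R n :=
  fun _ hf => mem_idealSpan.2 fun _ _ hR => hR n hf

theorem isIdeal_idealSpan (R : ∀ n, Set (FreeOperad K n)) : IsIdeal K (idealSpan R) where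
  perm_mem n σ _ hf := idealSpan_perm_stable R n σ hf
  comp_mem_left r k f g hf := mem_idealSpan.2 fun I hI hR =>
    hI.comp_mem_left r k f g (mem_idealSpan.1 hf I hI hR)
  comp_mem_right r k f g hg := mem_idealSpan.2 fun I hI hR =>
    hI.comp_mem_right r k f g (hg.imp fun _ h => mem_idealSpan.1 h I hI hR)

end FreeOperad

namespace QgrAlt

/-- The identities, for a pair of bilinear operations, that correspond to the defining relations
of the operad. -/
structure IsAlgebra : Prop where
  symm : ∀ x y, m x y = m y x
  skew : ∀ x y, b x y = -b y x
  bracket : ∀ x y z, b (b x y) z = -b (b x z) y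
  leibniz : ∀ x y z, b (m x y) z = m x (b y z) + m (b x z) y
  assoc : ∀ x y z, m (m x y) z = m x (m y z)

variable {m b}

theorem evalAt_mon {n : ℕ} (t : OpTree (Fin n)) (ht : t.leaves.Nodup ∧ ∀ i, i ∈ t.leaves)
    (a : Fin n → A) : FreeOperad.evalAt m b a (mon K t ht) = t.evalB m b a :=
  (FreeOperad.evalAt_apply m b a _).trans
    ((FreeOperad.eval_single m b _ 1 a).trans (one_smul K _))

theorem isAlgebra_iff : IsAlgebra m b ↔
    ∀ n (f : FreeOperad K n), Relations K n f → ∀ a, FreeOperad.eval m b f a = 0 := by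
  constructor
  · intro h n f hf a
    rw [← FreeOperad.evalAt_apply]
    cases hf <;>
      simp only [symmRel, skewRel, bracketRel, leibnizRel, assocRel, map_sub, map_add,
        evalAt_mon, OpTree.evalB, OpTree.eval]
    · rw [h.symm, sub_self]
    · rw [h.skew, neg_add_cancel]
    · rw [h.bracket, neg_add_cancel]
    · rw [h.leibniz, sub_self]
    · rw [h.assoc, sub_self]
  · intro h
    have h1 := fun x y => h _ _ .symm ![x, y]
    have h2 := fun x y => h _ _ .skew ![x, y]
    have h3 := fun x y z => h _ _ .bracket ![x, y, z]
    have h4 := fun x y z => h _ _ .leibniz ![x, y, z]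
    have h5 := fun x y z => h _ _ .assoc ![x, y, z]
    simp only [← FreeOperad.evalAt_apply, symmRel, skewRel, bracketRel, leibnizRel, assocRel,
      map_sub, map_add, evalAt_mon] at h1 h2 h3 h4 h5
    exact ⟨fun x y => sub_eq_zero.1 (h1 x y), fun x y => eq_neg_of_add_eq_zero_left (h2 x y),
      fun x y z => eq_neg_of_add_eq_zero_left (h3 x y z), fun x y z => sub_eq_zero.1 (h4 x y z),
      fun x y z => sub_eq_zero.1 (h5 x y z)⟩

theorem IsAlgebra.eval_eq_zero (h : IsAlgebra m b) {n : ℕ} {f : FreeOperad K n}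
    (hf : f ∈ ideal K n) : FreeOperad.eval m b f = 0 :=
  FreeOperad.idealSpan_le (FreeOperad.isIdeal_identities m b)
    (fun n _ hf => MultilinearMap.ext fun a => isAlgebra_iff.1 h n _ hf a) n hf

/-- The action of the operad on an algebra, with fixed arguments `a`. -/
noncomputable def IsAlgebra.evalComponent (h : IsAlgebra m b) {n : ℕ} (a : Fin n → A) :
    Component K n →ₗ[K] A :=
  (ideal K n).liftQ (FreeOperad.evalAt m b a) fun f hf => by
    rw [LinearMap.mem_ker, FreeOperad.evalAt_apply, h.eval_eq_zero hf, zero_apply]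

end QgrAlt

end EvalF

/-! ### The free algebra -/

section FreeAlgebra

variable (K : Type*) [Field K] {X Y : Type}

/-- The bilinear operation on the span of the trees with leaf labels in `X` that extends an
operation on trees. -/
noncomputable def freeOp (op : OpTree X → OpTree X → OpTree X) :
    (OpTree X →₀ K) →ₗ[K] (OpTree X →₀ K) →ₗ[K] (OpTree X →₀ K) :=
  Finsupp.linearCombination K fun s => Finsupp.lmapDomain K K (op s)

theorem freeOp_single (op : OpTree X → OpTree X → OpTree X) (s t : OpTree X) (c d : K) :
    freeOp K op (Finsupp.single s c) (Finsupp.single t d) = Finsupp.single (op s t) (c * d) := by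
  simp [freeOp]

/-- The basis vector of the free algebra given by a tree. -/
noncomputable abbrev treeVec (t : OpTree X) : OpTree X →₀ K := Finsupp.single t 1

theorem evalB_treeVec (u : Y → OpTree X) (t : OpTree Y) :
    t.evalB (freeOp K .dot) (freeOp K .br) (fun y => treeVec K (u y)) = treeVec K (t.graft u) := by
  induction t with
  | leaf x => rfl
  | dot s t hs ht =>
    rw [OpTree.evalB] at *
    rw [OpTree.eval, hs, ht, freeOp_single, one_mul, OpTree.graft]
  | br s t hs ht =>
    rw [OpTree.evalB] at *
    rw [OpTree.eval, hs, ht, freeOp_single, one_mul, OpTree.graft]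

/-- The multilinear operation on the free algebra given by an element of the free operad. -/
noncomputable abbrev freeEval {n : ℕ} (f : FreeOperad K n) (G : Fin n → OpTree X →₀ K) :
    OpTree X →₀ K :=
  FreeOperad.eval (freeOp K .dot) (freeOp K .br) f G

theorem freeEval_treeVec {n : ℕ} (f : FreeOperad K n) (u : Fin n → OpTree X) :
    freeEval K f (fun i => treeVec K (u i)) = f.sum fun t c => c • treeVec K (t.1.graft u) := by
  rw [freeEval, FreeOperad.eval_apply]
  simp only [evalB_treeVec]

variable {K}

/-- `f` is obtained from an element of the family `I` by an injective relabelling of the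
arguments with image `S`. -/
def Placed (I : ∀ n, Submodule K (FreeOperad K n)) (S : Set X) (f : OpTree X →₀ K) : Prop :=
  ∃ (m : ℕ) (f₀ : FreeOperad K m) (e : Fin m → X), f₀ ∈ I m ∧ Function.Injective e ∧
    Set.range e = S ∧ f = freeEval K f₀ fun j => treeVec K (.leaf (e j))

/-- Stability of an operadic ideal under composition, for arbitrary labels: a composition with
disjoint sets of arguments comes from the ideal as soon as one of the composed elements does. -/
theorem Placed.eval {I : ∀ n, Submodule K (FreeOperad K n)} (hI : FreeOperad.IsIdeal K I) {r : ℕ}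
    (f : FreeOperad K r) {S : Fin r → Set X} (hS : Pairwise (Function.onFun Disjoint S))
    {G : Fin r → OpTree X →₀ K} (hG : ∀ i, Placed (fun _ => ⊤) (S i) (G i))
    (h : f ∈ I r ∨ ∃ i, Placed I (S i) (G i)) : Placed I (⋃ i, S i) (freeEval K f G) := by
  have h' : ∀ i, ∃ (m : ℕ) (f₀ : FreeOperad K m) (e : Fin m → X), Function.Injective e ∧
      Set.range e = S i ∧ (G i = freeEval K f₀ fun j => treeVec K (.leaf (e j))) ∧
      (Placed I (S i) (G i) → f₀ ∈ I m) := by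
    intro i
    by_cases hi : Placed I (S i) (G i)
    · obtain ⟨m, f₀, e, h1, h2, h3, h4⟩ := hi
      exact ⟨m, f₀, e, h2, h3, h4, fun _ => h1⟩
    · obtain ⟨m, f₀, e, -, h2, h3, h4⟩ := hG i
      exact ⟨m, f₀, e, h2, h3, h4, fun h => absurd h hi⟩
  choose k g e he hr hg hP using h'
  refine ⟨∑ i, k i, FreeOperad.comp f g,
    fun x => e (finSigmaFinEquiv.symm x).1 (finSigmaFinEquiv.symm x).2, ?_, ?_, ?_, ?_⟩
  · rcases h with h | ⟨i, h⟩
    · exact hI.comp_mem_left r k f g h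
    · exact hI.comp_mem_right r k f g ⟨i, hP i h⟩
  · refine Function.Injective.comp (g := fun p : (i : Fin r) × Fin (k i) => e p.1 p.2) ?_
      finSigmaFinEquiv.symm.injective
    rintro ⟨i, a⟩ ⟨j, b⟩ hab
    simp only at hab
    by_cases hij : i = j
    · subst hij
      rw [he i hab]
    · refine absurd rfl ((hS hij).ne_of_mem (a := e i a) (b := e i a) ?_ ?_)
      · exact hr i ▸ ⟨a, rfl⟩
      · exact hr j ▸ ⟨b, hab.symm⟩
  · ext x
    simp only [Set.mem_range, Set.mem_iUnion, ← hr]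
    constructor
    · rintro ⟨y, rfl⟩
      exact ⟨_, _, rfl⟩
    · rintro ⟨i, j, rfl⟩
      exact ⟨finSigmaFinEquiv ⟨i, j⟩, by rw [Equiv.symm_apply_apply]⟩
  · rw [freeEval, freeEval, FreeOperad.eval_comp]
    congr 1
    funext i
    rw [hg i]
    have he' : ∀ p : (i : Fin r) × Fin (k i), e p.1 p.2 =
        e (finSigmaFinEquiv.symm (finSigmaFinEquiv p)).1 (finSigmaFinEquiv.symm (finSigmaFinEquiv p)).2 :=
      fun p => by rw [Equiv.symm_apply_apply]
    exact congrArg _ (funext fun j => congrArg (fun x => treeVec K (.leaf x)) (he' ⟨i, j⟩))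

/-- A tree with distinct leaf labels is a relabelled tree monomial. -/
theorem placed_top_treeVec {t : OpTree X} (ht : t.leaves.Nodup) :
    Placed (fun _ => ⊤) {x | x ∈ t.leaves} (treeVec K t) := by
  classical
  have h0 : 0 < t.leaves.length := List.length_pos_of_ne_nil t.leaves_ne_nil
  have : Nonempty (Fin t.leaves.length) := ⟨⟨0, h0⟩⟩
  have hinj : Function.Injective t.leaves.get := List.nodup_iff_injective_get.1 ht
  have hl : (t.relabel (Function.invFun t.leaves.get)).leaves = List.finRange t.leaves.length := by
    have h := congrArg (List.map (Function.invFun t.leaves.get)) (List.map_get_finRange t.leaves)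
    rw [OpTree.leaves_relabel, ← h, List.map_map, Function.invFun_comp hinj, List.map_id]
  let t₀ : TreeMonomial t.leaves.length := ⟨t.relabel (Function.invFun t.leaves.get), by
    rw [hl]
    exact ⟨List.nodup_finRange _, List.mem_finRange⟩⟩
  refine ⟨t.leaves.length, Finsupp.single t₀ 1, t.leaves.get, trivial, hinj, ?_, ?_⟩
  · exact Set.range_list_get _
  · rw [freeEval, FreeOperad.eval_single, one_smul, evalB_treeVec]
    change _ = treeVec K (t₀.1.relabel _)
    congr 1
    change t = (t.relabel _).relabel _
    rw [← OpTree.relabel_comp]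
    conv_lhs => rw [← OpTree.relabel_id t]
    refine OpTree.relabel_congr fun x hx => ?_
    obtain ⟨i, rfl⟩ := List.get_of_mem hx
    exact (Function.invFun_eq (f := t.leaves.get) ⟨i, rfl⟩).symm

theorem Placed.eq_sum {I : ∀ n, Submodule K (FreeOperad K n)} {S : Set X} {f : OpTree X →₀ K}
    (h : Placed I S f) : ∃ (m : ℕ) (f₀ : FreeOperad K m) (e : Fin m → X),
      Set.range e = S ∧ f = f₀.sum fun t c => c • treeVec K (t.1.relabel e) := by
  obtain ⟨m, f₀, e, -, -, h, rfl⟩ := h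
  exact ⟨m, f₀, e, h, freeEval_treeVec K f₀ _⟩

variable (X) in
/-- The span of the trees with a repeated leaf label and of all relabelled elements of the
family `I`. For an operadic ideal `I`, this is an ideal of the free algebra. -/
noncomputable def freeIdeal (I : ∀ n, Submodule K (FreeOperad K n)) : Submodule K (OpTree X →₀ K) :=
  Submodule.span K ({f | ∃ S, Placed I S f} ∪ {f | ∃ t, ¬ t.leaves.Nodup ∧ f = treeVec K t})

theorem treeVec_mem_freeIdeal (I : ∀ n, Submodule K (FreeOperad K n)) {t : OpTree X}
    (ht : ¬ t.leaves.Nodup) : treeVec K t ∈ freeIdeal X I :=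
  Submodule.subset_span (.inr ⟨t, ht, rfl⟩)

theorem Placed.mem_freeIdeal {I : ∀ n, Submodule K (FreeOperad K n)} {S : Set X}
    {f : OpTree X →₀ K} (h : Placed I S f) : f ∈ freeIdeal X I :=
  Submodule.subset_span (.inl ⟨S, h⟩)

/-- A binary operation on trees given by a tree monomial of arity two. -/
structure IsGraft (K : Type*) [Field K] (op : OpTree X → OpTree X → OpTree X) : Prop where
  leaves : ∀ s t, (op s t).leaves = s.leaves ++ t.leaves
  eval : ∃ w : FreeOperad K 2, ∀ f g, freeEval K w ![f, g] = freeOp K op f g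

theorem isGraft_dot : IsGraft K (OpTree.dot (X := X)) where
  leaves _ _ := rfl
  eval := ⟨QgrAlt.mon K (.dot (.leaf 0) (.leaf 1)) (by decide), fun f g => by
    rw [freeEval, ← FreeOperad.evalAt_apply, QgrAlt.evalAt_mon]; rfl⟩

theorem isGraft_br : IsGraft K (OpTree.br (X := X)) where
  leaves _ _ := rfl
  eval := ⟨QgrAlt.mon K (.br (.leaf 0) (.leaf 1)) (by decide), fun f g => by
    rw [freeEval, ← FreeOperad.evalAt_apply, QgrAlt.evalAt_mon]; rfl⟩

section Ideal

variable {I : ∀ n, Submodule K (FreeOperad K n)}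

/-- If the labels of `f` and `t` are disjoint, the product is a composition; otherwise it is a
combination of trees with a repeated leaf. -/
theorem Placed.freeOp_mem (hI : FreeOperad.IsIdeal K I) {op : OpTree X → OpTree X → OpTree X} (hop : IsGraft K op)
    {S : Set X} {f : OpTree X →₀ K} (hf : Placed I S f) (t : OpTree X) :
    freeOp K op f (treeVec K t) ∈ freeIdeal X I ∧ freeOp K op (treeVec K t) f ∈ freeIdeal X I := by
  have hf' : Placed (fun _ => ⊤) S f := by
    obtain ⟨m, f₀, e, -, h⟩ := hf
    exact ⟨m, f₀, e, trivial, h⟩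
  by_cases h : t.leaves.Nodup ∧ Disjoint S {x | x ∈ t.leaves}
  · obtain ⟨w, hw⟩ := hop.eval
    rw [← hw, ← hw]
    refine ⟨(Placed.eval hI w (S := ![S, {x | x ∈ t.leaves}]) ?_ ?_ (G := ![f, treeVec K t])
        (.inr ⟨0, hf⟩)).mem_freeIdeal,
      (Placed.eval hI w (S := ![{x | x ∈ t.leaves}, S]) ?_ ?_ (G := ![treeVec K t, f])
        (.inr ⟨1, hf⟩)).mem_freeIdeal⟩
    · intro i j hij
      fin_cases i <;> fin_cases j <;> first | exact absurd rfl hij | exact h.2 | exact h.2.symm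
    · exact Fin.forall_fin_two.2 ⟨hf', placed_top_treeVec h.1⟩
    · intro i j hij
      fin_cases i <;> fin_cases j <;> first | exact absurd rfl hij | exact h.2 | exact h.2.symm
    · exact Fin.forall_fin_two.2 ⟨placed_top_treeVec h.1, hf'⟩
  · obtain ⟨m, f₀, e, he, rfl⟩ := hf.eq_sum
    have hmem : ∀ (t₀ : TreeMonomial m), ∀ x ∈ S, x ∈ (t₀.1.relabel e).leaves := by
      rintro t₀ x hx
      rw [← he] at hx
      obtain ⟨i, rfl⟩ := hx
      rw [OpTree.leaves_relabel]
      exact List.mem_map_of_mem (t₀.2.2 i)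
    have key : ∀ t₀ : TreeMonomial m, ¬ (t.leaves.Nodup ∧
        List.Disjoint (t₀.1.relabel e).leaves t.leaves) := fun t₀ h' =>
      h ⟨h'.1, Set.disjoint_left.2 fun x hx hx' => h'.2 (hmem t₀ x hx) hx'⟩
    constructor
    · simp only [Finsupp.sum, map_sum, map_smul, LinearMap.sum_apply, LinearMap.smul_apply]
      refine Submodule.sum_mem _ fun t₀ _ => Submodule.smul_mem _ _ ?_
      rw [freeOp_single, one_mul]
      refine treeVec_mem_freeIdeal _ fun hn => ?_
      rw [hop.leaves, List.nodup_append'] at hn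
      exact key t₀ hn.2
    · simp only [Finsupp.sum, map_sum, map_smul]
      refine Submodule.sum_mem _ fun t₀ _ => Submodule.smul_mem _ _ ?_
      rw [freeOp_single, one_mul]
      refine treeVec_mem_freeIdeal _ fun hn => ?_
      rw [hop.leaves, List.nodup_append'] at hn
      exact key t₀ ⟨hn.1, hn.2.2.symm⟩

theorem freeOp_mem_freeIdeal (hI : FreeOperad.IsIdeal K I) {op : OpTree X → OpTree X → OpTree X} (hop : IsGraft K op)
    {f : OpTree X →₀ K} (hf : f ∈ freeIdeal X I) (g : OpTree X →₀ K) :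
    freeOp K op f g ∈ freeIdeal X I ∧ freeOp K op g f ∈ freeIdeal X I := by
  induction g using Finsupp.induction_linear with
  | zero => simp
  | add g g' hg hg' =>
    rw [map_add, map_add, LinearMap.add_apply]
    exact ⟨add_mem hg.1 hg'.1, add_mem hg.2 hg'.2⟩
  | single t c =>
    rw [← mul_one c, ← smul_eq_mul, ← Finsupp.smul_single, map_smul, map_smul,
      LinearMap.smul_apply]
    suffices h : freeOp K op f (treeVec K t) ∈ freeIdeal X I ∧
        freeOp K op (treeVec K t) f ∈ freeIdeal X I from
      ⟨Submodule.smul_mem _ _ h.1, Submodule.smul_mem _ _ h.2⟩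
    induction hf using Submodule.span_induction with
    | zero => simp
    | add f f' _ _ hf hf' =>
      rw [map_add, map_add, LinearMap.add_apply]
      exact ⟨add_mem hf.1 hf'.1, add_mem hf.2 hf'.2⟩
    | smul c f _ hf =>
      rw [map_smul, map_smul, LinearMap.smul_apply]
      exact ⟨Submodule.smul_mem _ _ hf.1, Submodule.smul_mem _ _ hf.2⟩
    | mem f hf =>
      rcases hf with ⟨S, hf⟩ | ⟨s, hs, rfl⟩
      · exact hf.freeOp_mem hI hop t
      · rw [freeOp_single, freeOp_single, one_mul]
        constructor <;> refine treeVec_mem_freeIdeal _ fun hn => hs ?_ <;>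
          rw [hop.leaves, List.nodup_append'] at hn
        exacts [hn.1, hn.2.1]

/-- All values of the elements of an operadic ideal `I` on the free algebra lie in
`freeIdeal X I`. -/
theorem freeEval_mem_freeIdeal (hI : FreeOperad.IsIdeal K I) {r : ℕ} {f : FreeOperad K r} (hf : f ∈ I r)
    (G : Fin r → OpTree X →₀ K) : freeEval K f G ∈ freeIdeal X I := by
  suffices h : (freeIdeal X I).mkQ.compMultilinearMap
      (FreeOperad.eval (freeOp K .dot) (freeOp K .br) f) = 0 by
    rw [← Submodule.ker_mkQ (freeIdeal X I), LinearMap.mem_ker]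
    exact congrArg (fun φ => φ G) h
  refine Module.Basis.ext_multilinear (fun _ => Finsupp.basisSingleOne) fun u => ?_
  simp only [Finsupp.coe_basisSingleOne, LinearMap.compMultilinearMap_apply, zero_apply]
  rw [← LinearMap.mem_ker, Submodule.ker_mkQ]
  by_cases h : (∀ i, (u i).leaves.Nodup) ∧
      Pairwise (Function.onFun Disjoint fun i => {x | x ∈ (u i).leaves})
  · exact (Placed.eval hI f h.2 (fun i => placed_top_treeVec (h.1 i)) (.inl hf)).mem_freeIdeal
  · refine (congrArg (· ∈ freeIdeal X I) (freeEval_treeVec K f u)).mpr ?_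
    refine Submodule.sum_mem _ fun t _ => Submodule.smul_mem _ _ ?_
    refine treeVec_mem_freeIdeal _ fun hn => h ?_
    rw [OpTree.leaves_graft, List.nodup_flatMap] at hn
    have : Std.Symm fun a b => List.Disjoint (u a).leaves (u b).leaves :=
      ⟨fun _ _ => List.Disjoint.symm⟩
    refine ⟨fun i => hn.1 i (t.2.2 i), fun i j hij => Set.disjoint_left.2 fun x hx hx' => ?_⟩
    exact hn.2.forall (R := fun a b => List.Disjoint (u a).leaves (u b).leaves)
      (t.2.2 i) (t.2.2 j) hij hx hx'

end Ideal

namespace QgrAlt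

theorem isIdeal_ideal : FreeOperad.IsIdeal K (ideal K) :=
  FreeOperad.isIdeal_idealSpan _

variable (K X) in
/-- The quotient of the span of all trees with leaf labels in `X` by `freeIdeal`: an algebra with a
product and a bracket that satisfies the defining relations, with generators `FreeAlg.gen x`. -/
abbrev FreeAlg : Type _ := (OpTree X →₀ K) ⧸ freeIdeal X (ideal K)

/-- The operation on `FreeAlg K X` induced by grafting trees. -/
noncomputable def FreeAlg.op {op : OpTree X → OpTree X → OpTree X} (hop : IsGraft K op) :
    FreeAlg K X →ₗ[K] FreeAlg K X →ₗ[K] FreeAlg K X :=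
  ((freeOp K op).compr₂ (freeIdeal X (ideal K)).mkQ).liftQ₂ _ _
    (fun _ hf => LinearMap.ext fun g =>
      (Submodule.Quotient.mk_eq_zero _).2 (freeOp_mem_freeIdeal isIdeal_ideal hop hf g).1)
    (fun _ hf => LinearMap.ext fun g =>
      (Submodule.Quotient.mk_eq_zero _).2 (freeOp_mem_freeIdeal isIdeal_ideal hop hf g).2)

/-- The generators of `FreeAlg K X`. -/
noncomputable def FreeAlg.gen (x : X) : FreeAlg K X :=
  Submodule.Quotient.mk (treeVec K (.leaf x))

theorem FreeAlg.evalB_mk {Y : Type} (G : Y → OpTree X →₀ K) (t : OpTree Y) :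
    t.evalB (FreeAlg.op isGraft_dot) (FreeAlg.op isGraft_br)
        (fun y => (Submodule.Quotient.mk (G y) : FreeAlg K X)) =
      Submodule.Quotient.mk (t.evalB (freeOp K .dot) (freeOp K .br) G) :=
  (OpTree.map_eval (fun f => (Submodule.Quotient.mk f : FreeAlg K X))
    (fun _ _ => rfl) (fun _ _ => rfl) G t).symm

theorem FreeAlg.evalB_gen (t : OpTree X) :
    t.evalB (FreeAlg.op isGraft_dot) (FreeAlg.op isGraft_br) (FreeAlg.gen (K := K)) =
      Submodule.Quotient.mk (treeVec K t) := by
  refine (FreeAlg.evalB_mk _ t).trans ?_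
  rw [evalB_treeVec K OpTree.leaf t]
  exact congrArg _ (congrArg _ (OpTree.relabel_id t))

theorem FreeAlg.isAlgebra :
    IsAlgebra (FreeAlg.op (isGraft_dot (K := K) (X := X))) (FreeAlg.op isGraft_br) := by
  refine isAlgebra_iff.2 fun n f hf a => ?_
  obtain ⟨G, rfl⟩ : ∃ G : Fin n → OpTree X →₀ K, (fun i => Submodule.Quotient.mk (G i)) = a :=
    ⟨fun i => (a i).out, funext fun i => Quotient.out_eq' _⟩
  rw [FreeOperad.eval_apply]
  simp only [FreeAlg.evalB_mk]
  have h := freeEval_mem_freeIdeal isIdeal_ideal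
    (FreeOperad.subset_idealSpan (fun m => {f | Relations K m f}) n hf) G
  rw [freeEval, FreeOperad.eval_apply] at h
  refine Eq.trans ?_ ((Submodule.Quotient.mk_eq_zero _).2 h)
  simp only [Finsupp.sum, ← Submodule.mkQ_apply, map_sum, map_smul]

open Classical in
/-- The class of a tree in the operad, or `0` if the tree is not a tree monomial. -/
noncomputable def treeClass {n : ℕ} (t : OpTree (Fin n)) : Component K n :=
  if h : t.leaves.Nodup ∧ ∀ i, i ∈ t.leaves then (ideal K n).mkQ (mon K t h) else 0

/-- If a relabelled element of the operadic ideal uses all arguments, the relabelling is a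
permutation; otherwise none of its trees is a tree monomial. -/
theorem freeIdeal_le_ker (n : ℕ) : freeIdeal (Fin n) (ideal K) ≤
    LinearMap.ker (Finsupp.linearCombination K (treeClass (K := K) (n := n))) := by
  refine Submodule.span_le.2 ?_
  rintro f (⟨S, m, f₀, e, hf, he, -, rfl⟩ | ⟨t, ht, rfl⟩) <;> rw [SetLike.mem_coe, LinearMap.mem_ker]
  · rw [freeEval_treeVec K f₀ (fun j => .leaf (e j)), map_finsuppSum]
    simp only [map_smul, Finsupp.linearCombination_single, one_smul]
    by_cases hs : Function.Surjective e
    · obtain rfl : m = n := by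
        simpa using Fintype.card_congr (Equiv.ofBijective e ⟨he, hs⟩)
      let σ : Equiv.Perm (Fin m) := Equiv.ofBijective e ⟨he, hs⟩
      have h : (ideal K m).mkQ (FreeOperad.permRep K m σ f₀) = 0 :=
        (Submodule.Quotient.mk_eq_zero _).2 (isIdeal_ideal.perm_mem m σ f₀ hf)
      rw [← h, FreeOperad.permRep, MonoidHom.coe_mk, OneHom.coe_mk, Finsupp.lmapDomain_apply,
        Finsupp.mapDomain, map_finsuppSum]
      refine Finsupp.sum_congr fun t _ => ?_
      rw [← mul_one (f₀ t), ← smul_eq_mul, ← Finsupp.smul_single, map_smul, smul_eq_mul, mul_one]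
      exact congrArg _ (dif_pos (TreeMonomial.perm σ t).2)
    · refine Finset.sum_eq_zero fun t _ => ?_
      refine (congrArg _ (dif_neg fun h => hs fun i => ?_)).trans (smul_zero _)
      have hi := h.2 i
      change i ∈ (t.1.relabel e).leaves at hi
      rw [OpTree.leaves_relabel] at hi
      obtain ⟨j, -, hj⟩ := List.mem_map.1 hi
      exact ⟨j, hj⟩
  · rw [Finsupp.linearCombination_single, one_smul]
    exact dif_neg fun h => ht h.1

/-- The projection of the free algebra on `n` generators onto its multilinear part. -/
noncomputable def FreeAlg.toComponent (n : ℕ) : FreeAlg K (Fin n) →ₗ[K] Component K n :=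
  (freeIdeal (Fin n) (ideal K)).liftQ _ (freeIdeal_le_ker n)

theorem FreeAlg.toComponent_evalB {n : ℕ} (t : OpTree (Fin n)) :
    FreeAlg.toComponent n (t.evalB (FreeAlg.op isGraft_dot) (FreeAlg.op isGraft_br)
      (FreeAlg.gen (K := K))) = treeClass t := by
  rw [FreeAlg.evalB_gen]
  exact (Finsupp.linearCombination_single K _ _).trans (one_smul K _)

end QgrAlt

end FreeAlgebra

/-! ### Consequences of the relations in a unital algebra -/

namespace QgrAlt

section Unital

variable {K : Type*} [Field K] {C : Type*} [CommRing C] [Algebra K C]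
  {b : C →ₗ[K] C →ₗ[K] C}

theorem eq_zero_of_eq_neg_self (h2 : (2 : K) ≠ 0) {x : C} (hx : x = -x) : x = 0 := by
  have h : (2 : K) • x = 0 := by rw [two_smul]; nth_rw 2 [hx]; exact add_neg_cancel x
  exact (smul_eq_zero.1 h).resolve_left h2

namespace IsAlgebra

theorem leibniz_left (h : IsAlgebra (LinearMap.mul K C) b) (x y z : C) :
    b (x * y) z = x * b y z + b x z * y :=
  h.leibniz x y z

theorem leibniz_right (h : IsAlgebra (LinearMap.mul K C) b) (x y z : C) :
    b x (y * z) = y * b x z + b x y * z := by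
  rw [h.skew, h.leibniz_left, h.skew z, h.skew y]; ring

theorem bracket_one (h : IsAlgebra (LinearMap.mul K C) b) (z : C) : b 1 z = 0 := by
  have := h.leibniz_left 1 1 z
  rw [mul_one, one_mul, mul_one] at this
  exact left_eq_add.1 this

theorem bracket_rotate (h : IsAlgebra (LinearMap.mul K C) b) (x y z : C) :
    b (b x y) z = b (b z x) y := by
  rw [h.bracket, h.skew x z, map_neg, LinearMap.neg_apply, neg_neg]

/-- A product of two brackets changes sign when an argument of the first bracket is exchanged with
one of the second. This compares the two expansions of `[[wx, y], z] = -[[wx, z], y]`. -/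
theorem bracket_mul_bracket (h : IsAlgebra (LinearMap.mul K C) b) (h2 : (2 : K) ≠ 0)
    (w x y z : C) : b w y * b x z = -(b w z * b x y) := by
  have h' := h.bracket (w * x) y z
  rw [h.leibniz_left, h.leibniz_left, map_add, map_add, LinearMap.add_apply, LinearMap.add_apply,
    h.leibniz_left, h.leibniz_left, h.leibniz_left, h.leibniz_left, h.bracket x z y,
    h.bracket w z y] at h'
  refine sub_eq_zero.1 (eq_zero_of_eq_neg_self h2 ?_)
  linear_combination h'

/-- Brackets of depth three vanish: both `[[[w, x], y], z]` and `[[y, z], [w, x]]` are totally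
skew-symmetric, and the skew symmetry of the outer bracket of the latter contradicts the parity of
the permutation that exchanges the pairs. -/
theorem bracket_bracket_bracket (h : IsAlgebra (LinearMap.mul K C) b) (h2 : (2 : K) ≠ 0)
    (w x y z : C) : b (b (b w x) y) z = 0 := by
  refine eq_zero_of_eq_neg_self h2 ?_
  have h1 : b (b w x) (b y z) = -b (b (b w x) y) z := by
    rw [h.skew (b w x), h.bracket, neg_neg, h.skew y, map_neg, LinearMap.neg_apply]
  have h3 : b (b w x) (b y z) = b (b (b y z) w) x := by
    rw [h.bracket, h.skew w, map_neg, LinearMap.neg_apply, neg_neg]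
  rw [← h1, h3, h.bracket_rotate y z w, h.bracket w x y, map_neg, LinearMap.neg_apply,
    h.bracket (b w y) x z, neg_neg]

theorem bracket_of_brackets (h : IsAlgebra (LinearMap.mul K C) b) (h2 : (2 : K) ≠ 0)
    (w x y z : C) : b (b w x) (b y z) = 0 := by
  rw [h.bracket, h.skew w, map_neg, LinearMap.neg_apply, neg_neg, h.bracket_bracket_bracket h2]

theorem triple_mul_triple (h : IsAlgebra (LinearMap.mul K C) b) (h2 : (2 : K) ≠ 0)
    (u v w x y z : C) : b (b u v) w * b (b x y) z = 0 := by
  rw [h.skew (b x y), mul_neg, h.bracket_mul_bracket h2, h.bracket_of_brackets h2, zero_mul,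
    neg_zero, neg_zero]

/-- The left-hand side is skew-symmetric in `x`, `y`, `z`, and by `bracket_mul_bracket` it changes
sign when `w` and `z` are exchanged; a third exchange gives the claim. -/
theorem bracket_mul_triple (h : IsAlgebra (LinearMap.mul K C) b) (h2 : (2 : K) ≠ 0)
    (v w x y z : C) : b v w * b (b x y) z = -(b v x * b (b w y) z) := by
  have r : ∀ x y z : C, b (b x y) z = -b (b z y) x := fun x y z => by
    rw [h.bracket_rotate, h.bracket]
  rw [r x, mul_neg, h.bracket_mul_bracket h2, neg_neg, r z, mul_neg]

end IsAlgebra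

/-- The skew-symmetric element of degree `l.length`: `[a₁, a₂] [a₃, a₄] ⋯` if the degree is even,
`[a₁, a₂] ⋯ [[a₍ₙ₋₂₎, a₍ₙ₋₁₎], aₙ]` if it is odd. There is no such element in degree one, where the
value is a convention that plays no role. -/
def skewProd (b : C →ₗ[K] C →ₗ[K] C) : List C → C
  | [] => 1
  | [x] => x
  | [x, y] => b x y
  | [x, y, z] => b (b x y) z
  | x :: y :: z :: w :: l => b x y * skewProd b (z :: w :: l)

theorem skewProd_cons_cons (x y : C) {l : List C} (hl : l.length ≠ 1) :
    skewProd b (x :: y :: l) = b x y * skewProd b l := by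
  match l with
  | [] => rw [skewProd, skewProd, mul_one]
  | [_] => exact absurd rfl hl
  | _ :: _ :: _ => rw [skewProd]

namespace IsAlgebra

theorem skewProd_swap_head (h : IsAlgebra (LinearMap.mul K C) b) (x y : C) (l : List C) :
    skewProd b (x :: y :: l) = -skewProd b (y :: x :: l) := by
  match l with
  | [] => exact h.skew x y
  | [z] => rw [skewProd, skewProd, h.skew x, map_neg, LinearMap.neg_apply]
  | z :: w :: l => rw [skewProd, skewProd, h.skew x, neg_mul]

theorem skewProd_swap_second (h : IsAlgebra (LinearMap.mul K C) b) (h2 : (2 : K) ≠ 0)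
    (a x y : C) (l : List C) :
    skewProd b (a :: x :: y :: l) = -skewProd b (a :: y :: x :: l) := by
  have quad : ∀ z, b a x * b y z = -(b a y * b x z) := fun z => by
    rw [h.bracket_mul_bracket h2 a y x z, h.skew y x, mul_neg, neg_neg, h.bracket_mul_bracket h2]
  match l with
  | [] => exact h.bracket a x y
  | [z] => exact quad z
  | [z, w] => exact h.bracket_mul_triple h2 a x y z w
  | z :: w :: v :: l =>
    simp only [skewProd]
    rw [← mul_assoc, quad, ← mul_assoc, neg_mul]

/-- `skewProd` changes sign when two neighbouring arguments are exchanged. -/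
theorem skewProd_swap (h : IsAlgebra (LinearMap.mul K C) b) (h2 : (2 : K) ≠ 0) (x y : C)
    (l l' : List C) : skewProd b (l ++ x :: y :: l') = -skewProd b (l ++ y :: x :: l') := by
  match l with
  | [] => exact h.skewProd_swap_head x y l'
  | [a] => exact h.skewProd_swap_second h2 a x y l'
  | a :: c :: l =>
    rw [List.cons_append, List.cons_append, List.cons_append, List.cons_append,
      skewProd_cons_cons _ _ (by simp; omega), skewProd_cons_cons _ _ (by simp; omega),
      h.skewProd_swap h2 x y l l', mul_neg]

theorem skewProd_ofFn_swap (h : IsAlgebra (LinearMap.mul K C) b) (h2 : (2 : K) ≠ 0) {n : ℕ}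
    (i : Fin n) (v : Fin (n + 1) → C) :
    skewProd b (List.ofFn (v ∘ Equiv.swap i.castSucc i.succ)) = -skewProd b (List.ofFn v) := by
  have e : ∀ w : Fin (n + 1) → C, List.ofFn w =
      (List.ofFn w).take i ++ w i.castSucc :: w i.succ :: (List.ofFn w).drop (i + 2) := by
    intro w
    conv_lhs => rw [← List.take_append_drop i (List.ofFn w),
      List.drop_eq_getElem_cons (by simp), List.drop_eq_getElem_cons (by simp)]
    simp only [List.getElem_ofFn]
    rfl
  have ne : ∀ j : Fin (n + 1), (j : ℕ) ≠ i → (j : ℕ) ≠ i + 1 →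
      Equiv.swap i.castSucc i.succ j = j := fun j h h' =>
    Equiv.swap_apply_of_ne_of_ne (fun e => h (by simp [e])) (fun e => h' (by simp [e]))
  rw [e, e v, h.skewProd_swap h2]
  congr 3
  · refine List.ext_getElem (by simp) fun j hj _ => ?_
    simp only [List.length_take, List.length_ofFn] at hj
    simp only [List.getElem_take, List.getElem_ofFn, Function.comp_apply]
    rw [ne _ (by simp; omega) (by simp; omega)]
  · simp only [Function.comp_apply, Equiv.swap_apply_left, Equiv.swap_apply_right]
    congr 2
    refine List.ext_getElem (by simp) fun j hj _ => ?_
    simp only [List.getElem_drop, List.getElem_ofFn, Function.comp_apply]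
    rw [ne _ (by simp; omega) (by simp; omega)]

/-- `skewProd` is skew-symmetric. -/
theorem skewProd_ofFn_perm (h : IsAlgebra (LinearMap.mul K C) b) (h2 : (2 : K) ≠ 0) {n : ℕ}
    (σ : Equiv.Perm (Fin n)) (v : Fin n → C) :
    skewProd b (List.ofFn (v ∘ σ)) =
      ((Equiv.Perm.sign σ : ℤˣ) : ℤ) • skewProd b (List.ofFn v) := by
  cases n with
  | zero => simp [Subsingleton.elim σ 1]
  | succ n =>
    have hσ : σ ∈ Submonoid.closure
        (Set.range fun i : Fin n => Equiv.swap i.castSucc i.succ) := by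
      rw [Equiv.Perm.mclosure_swap_castSucc_succ]; trivial
    induction hσ using Submonoid.closure_induction generalizing v with
    | one => simp
    | mul σ τ _ _ hσ hτ =>
      rw [Equiv.Perm.coe_mul, ← Function.comp_assoc, hτ, hσ, smul_smul, Equiv.Perm.sign_mul,
        Units.val_mul, mul_comm]
    | mem σ hσ =>
      obtain ⟨i, rfl⟩ := hσ
      rw [h.skewProd_ofFn_swap h2, Equiv.Perm.sign_swap (Fin.castSucc_lt_succ).ne]
      simp

/-- The product vanishes if `skewProd b l` already contains a double bracket. -/
theorem skewProd_mul_triple (h : IsAlgebra (LinearMap.mul K C) b) (h2 : (2 : K) ≠ 0)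
    (x y z : C) (l : List C) (hl : l.length ≠ 1) :
    skewProd b l * b (b x y) z = skewProd b (l ++ [x, y, z]) ∨
      skewProd b l * b (b x y) z = 0 := by
  match l with
  | [] => left; rw [skewProd, one_mul]; rfl
  | [_] => exact absurd rfl hl
  | [_, _] => left; rfl
  | [_, _, _] => right; exact h.triple_mul_triple h2 _ _ _ _ _ _
  | u :: v :: w :: w' :: l =>
    rcases h.skewProd_mul_triple h2 x y z (w :: w' :: l) (by simp) with h' | h'
    · left; rw [skewProd, mul_assoc, h']; rfl
    · right; rw [skewProd, mul_assoc, h', mul_zero]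

end IsAlgebra

end Unital

end QgrAlt

/-! ### Spanning normal forms -/

namespace QgrAlt

section Span

variable {K : Type*} [Field K] {C : Type*} [CommRing C] [Algebra K C]
  {b : C →ₗ[K] C →ₗ[K] C} {X : Type}

/-- The generators `a i` and their nonzero brackets, with the multiset of the arguments used. -/
inductive IsAtom (b : C →ₗ[K] C →ₗ[K] C) (a : X → C) : Multiset X → C → Prop
  | gen (i : X) : IsAtom b a {i} (a i)
  | pair (i j : X) : IsAtom b a {i, j} (b (a i) (a j))
  | triple (i j k : X) : IsAtom b a {i, j, k} (b (b (a i) (a j)) (a k))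

/-- Products of atoms, with the multiset of the arguments used. -/
inductive IsAtomProd (b : C →ₗ[K] C →ₗ[K] C) (a : X → C) : Multiset X → C → Prop
  | one : IsAtomProd b a 0 1
  | mul {M N : Multiset X} {x p : C} : IsAtom b a M x → IsAtomProd b a N p →
      IsAtomProd b a (M + N) (x * p)

/-- The span of the products of atoms that use the arguments in `M`. -/
def atomSpan (b : C →ₗ[K] C →ₗ[K] C) (a : X → C) (M : Multiset X) : Submodule K C :=
  Submodule.span K {p | IsAtomProd b a M p}

variable {a : X → C}

theorem IsAtomProd.mul' {M N : Multiset X} {p q : C} (hp : IsAtomProd b a M p)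
    (hq : IsAtomProd b a N q) : IsAtomProd b a (M + N) (p * q) := by
  induction hp with
  | one => rwa [zero_add, one_mul]
  | mul hx _ ih => rw [add_assoc, mul_assoc]; exact .mul hx ih

theorem IsAtom.isAtomProd {M : Multiset X} {x : C} (hx : IsAtom b a M x) :
    IsAtomProd b a M x := by
  have h := IsAtomProd.mul hx .one
  rwa [add_zero, mul_one] at h

theorem map₂_mem_of_span {M N P : Type*} [AddCommGroup M] [Module K M] [AddCommGroup N]
    [Module K N] [AddCommGroup P] [Module K P] (f : M →ₗ[K] N →ₗ[K] P) {s : Set M} {t : Set N}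
    {W : Submodule K P} (h : ∀ x ∈ s, ∀ y ∈ t, f x y ∈ W) {x : M} {y : N}
    (hx : x ∈ Submodule.span K s) (hy : y ∈ Submodule.span K t) : f x y ∈ W := by
  have h' : Submodule.map₂ f (Submodule.span K s) (Submodule.span K t) ≤ W := by
    rw [Submodule.map₂_span_span, Submodule.span_le]
    rintro _ ⟨x, hx, y, hy, rfl⟩
    exact h x hx y hy
  exact h' (Submodule.apply_mem_map₂ f hx hy)

theorem mul_mem_atomSpan {M N : Multiset X} {p q : C} (hp : p ∈ atomSpan b a M)
    (hq : q ∈ atomSpan b a N) : p * q ∈ atomSpan b a (M + N) :=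
  map₂_mem_of_span (LinearMap.mul K C)
    (fun _ hp _ hq => Submodule.subset_span (IsAtomProd.mul' hp hq)) hp hq

namespace IsAlgebra

theorem bracket_atom_atom (h : IsAlgebra (LinearMap.mul K C) b) (h2 : (2 : K) ≠ 0)
    {M N : Multiset X} {x y : C} (hx : IsAtom b a M x) (hy : IsAtom b a N y) :
    b x y ∈ atomSpan b a (M + N) := by
  have mem : ∀ {M : Multiset X} {x : C}, IsAtom b a M x → x ∈ atomSpan b a M :=
    fun hx => Submodule.subset_span hx.isAtomProd
  cases hx with
  | gen i =>
    cases hy with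
    | gen j => exact mem (.pair i j)
    | pair j k =>
      rw [h.skew, add_comm]
      exact neg_mem (mem (.triple j k i))
    | triple j k l =>
      rw [h.skew, h.bracket_bracket_bracket h2, neg_zero]
      exact zero_mem _
  | pair i j =>
    cases hy with
    | gen k => exact mem (.triple i j k)
    | pair k l => rw [h.bracket_of_brackets h2]; exact zero_mem _
    | triple k l m => rw [h.bracket_of_brackets h2]; exact zero_mem _
  | triple i j k => rw [h.bracket_bracket_bracket h2]; exact zero_mem _

theorem bracket_atom_atomProd (h : IsAlgebra (LinearMap.mul K C) b) (h2 : (2 : K) ≠ 0)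
    {M N : Multiset X} {x q : C} (hx : IsAtom b a M x) (hq : IsAtomProd b a N q) :
    b x q ∈ atomSpan b a (M + N) := by
  induction hq with
  | one => rw [h.skew, h.bracket_one, neg_zero]; exact zero_mem _
  | @mul N N' y q hy hq ih =>
    rw [h.leibniz_right]
    refine add_mem ?_ ?_
    · rw [add_left_comm]
      exact mul_mem_atomSpan (Submodule.subset_span hy.isAtomProd) ih
    · rw [← add_assoc]
      exact mul_mem_atomSpan (h.bracket_atom_atom h2 hx hy) (Submodule.subset_span hq)

theorem bracket_mem_atomSpan (h : IsAlgebra (LinearMap.mul K C) b) (h2 : (2 : K) ≠ 0)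
    {M N : Multiset X} {p q : C} (hp : p ∈ atomSpan b a M)
    (hq : q ∈ atomSpan b a N) : b p q ∈ atomSpan b a (M + N) := by
  refine map₂_mem_of_span b (fun p hp q hq => ?_) hp hq
  clear * - h h2 hp hq
  change IsAtomProd b a M p at hp
  change IsAtomProd b a N q at hq
  induction hp with
  | one => rw [h.bracket_one]; exact zero_mem _
  | @mul M M' x p hx hp ih =>
    rw [h.leibniz_left]
    refine add_mem ?_ ?_
    · rw [add_assoc]
      exact mul_mem_atomSpan (Submodule.subset_span hx.isAtomProd) ih
    · rw [add_right_comm]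
      exact mul_mem_atomSpan (h.bracket_atom_atomProd h2 hx hq) (Submodule.subset_span hp)

theorem evalB_mem_atomSpan (h : IsAlgebra (LinearMap.mul K C) b) (h2 : (2 : K) ≠ 0)
    (t : OpTree X) : t.evalB (LinearMap.mul K C) b a ∈ atomSpan b a (t.leaves : Multiset X) := by
  induction t with
  | leaf x => exact Submodule.subset_span (IsAtom.gen x).isAtomProd
  | dot s t hs ht =>
    rw [OpTree.leaves, ← Multiset.coe_add]
    exact mul_mem_atomSpan hs ht
  | br s t hs ht =>
    rw [OpTree.leaves, ← Multiset.coe_add]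
    exact h.bracket_mem_atomSpan h2 hs ht

end IsAlgebra

variable (b a) in
/-- The product of the generators with indices in `l` and of the skew-symmetric element whose
arguments are the generators with indices in `l'`. -/
def normalForm (l l' : List X) : C :=
  (l.map a).prod * skewProd b (l'.map a)

/-- Every value of a tree is a combination of normal forms with the same arguments. -/
theorem IsAlgebra.evalB_mem_span_normalForm (h : IsAlgebra (LinearMap.mul K C) b)
    (h2 : (2 : K) ≠ 0) (t : OpTree X) :
    t.evalB (LinearMap.mul K C) b a ∈ Submodule.span K {p | ∃ l l' : List X,
      (l ++ l').Perm t.leaves ∧ l'.length ≠ 1 ∧ p = normalForm b a l l'} := by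
  refine Submodule.span_le.2 ?_ (h.evalB_mem_atomSpan h2 t)
  suffices H : ∀ (M : Multiset X) (p : C), IsAtomProd b a M p → p ∈ Submodule.span K
      {p | ∃ l l' : List X, ((l ++ l' : List X) : Multiset X) = M ∧ l'.length ≠ 1 ∧
        p = normalForm b a l l'} by
    intro p hp
    refine Submodule.span_mono ?_ (H _ p hp)
    rintro _ ⟨l, l', h1, h3⟩
    exact ⟨l, l', Multiset.coe_eq_coe.1 h1, h3⟩
  intro M p hp
  induction hp with
  | one => exact Submodule.subset_span ⟨[], [], rfl, by simp, by simp [normalForm, skewProd]⟩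
  | @mul M N x p hx hp ih =>
    clear hp
    induction ih using Submodule.span_induction with
    | zero => rw [mul_zero]; exact zero_mem _
    | add p q _ _ hp hq => rw [mul_add]; exact add_mem hp hq
    | smul c p _ hp => rw [mul_smul_comm]; exact Submodule.smul_mem _ c hp
    | mem p hp =>
      obtain ⟨l, l', rfl, hl, rfl⟩ := hp
      cases hx with
      | gen i =>
        refine Submodule.subset_span ⟨i :: l, l', rfl, hl, ?_⟩
        simp only [normalForm, List.map_cons, List.prod_cons, mul_assoc]
      | pair i j =>
        refine Submodule.subset_span ⟨l, i :: j :: l', ?_, by simp, ?_⟩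
        · change _ = (([i, j] ++ (l ++ l') : List X) : Multiset X)
          rw [Multiset.coe_eq_coe]
          exact List.perm_append_comm_assoc l [i, j] l'
        · rw [normalForm, normalForm, List.map_cons, List.map_cons,
            skewProd_cons_cons _ _ (by simpa using hl), mul_left_comm]
      | triple i j k =>
        rcases h.skewProd_mul_triple h2 (a i) (a j) (a k) (l'.map a) (by simpa using hl) with h' | h'
        · refine Submodule.subset_span ⟨l, l' ++ [i, j, k], ?_, by simp, ?_⟩
          · change _ = (([i, j, k] ++ (l ++ l') : List X) : Multiset X)
            rw [Multiset.coe_eq_coe, ← List.append_assoc]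
            exact List.perm_append_comm
          · rw [normalForm, normalForm, List.map_append, List.map_cons, List.map_cons,
              List.map_cons, List.map_nil, ← h']
            ring
        · rw [normalForm, mul_left_comm, mul_comm (b _ _), h', mul_zero]
          exact zero_mem _

end Span

end QgrAlt

/-! ### Unitization, and normal forms as trees -/

namespace QgrAlt

universe u

/-- An algebra embeds into its unitization, with the bracket extended by `[1, x] = 0`; this makes
the results on unital algebras available. -/
theorem IsAlgebra.exists_unital {K : Type u} [Field K] {A : Type u} [AddCommGroup A] [Module K A]
    {m b : A →ₗ[K] A →ₗ[K] A} (h : IsAlgebra m b) :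
    ∃ (C : Type u) (_ : CommRing C) (_ : Algebra K C) (b' : C →ₗ[K] C →ₗ[K] C)
      (i : A →ₗ[K] C) (p : C →ₗ[K] A), IsAlgebra (LinearMap.mul K C) b' ∧ (∀ x, p (i x) = x) ∧
        (∀ x y, i (m x y) = i x * i y) ∧ ∀ x y, i (b x y) = b' (i x) (i y) := by
  let : NonUnitalCommRing A :=
    { ‹AddCommGroup A› with
      mul := fun x y => m x y
      left_distrib := fun x y z => map_add (m x) y z
      right_distrib := fun x y z => LinearMap.map_add₂ m x y z
      zero_mul := fun x => LinearMap.map_zero₂ m x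
      mul_zero := fun x => map_zero (m x)
      mul_assoc := h.assoc
      mul_comm := h.symm }
  have hmul : ∀ x y : A, x * y = m x y := fun _ _ => rfl
  have : IsScalarTower K A A := ⟨fun c x y => LinearMap.map_smul₂ m c x y⟩
  have : SMulCommClass K A A := ⟨fun c x y => (map_smul (m x) c y).symm⟩
  let b' : Unitization K A →ₗ[K] Unitization K A →ₗ[K] Unitization K A :=
    (b.compl₁₂ (Unitization.sndHom K K A) (Unitization.sndHom K K A)).compr₂ (Unitization.inrHom K K A)
  have hb : ∀ x y : Unitization K A, b' x y = Unitization.inr (b x.snd y.snd) := fun _ _ => rfl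
  refine ⟨Unitization K A, inferInstance, inferInstance, b', Unitization.inrHom K K A,
    Unitization.sndHom K K A, ?_, fun _ => rfl, fun x y => ?_, fun x y => rfl⟩
  · constructor
    · exact mul_comm
    · intro x y
      rw [hb, hb, h.skew, Unitization.inr_neg]
    · intro x y z
      simp only [hb, Unitization.snd_inr]
      rw [h.bracket, Unitization.inr_neg]
    · intro x y z
      simp only [hb, LinearMap.mul_apply']
      refine Unitization.ext (by simp) ?_
      simp only [Unitization.snd_inr, Unitization.snd_mul, Unitization.snd_add,
        Unitization.fst_inr, map_add, map_smul, LinearMap.add_apply, LinearMap.smul_apply, hmul,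
        h.leibniz, zero_smul, add_zero, zero_add]
      abel
    · exact mul_assoc
  · exact Unitization.inr_mul K x y

section Tree

variable (K : Type u) [Field K] {X : Type}

theorem exists_tree_skewProd (l : List X) (hl : 2 ≤ l.length) :
    ∃ t : OpTree X, t.leaves = l ∧ ∀ (C : Type u) [CommRing C] [Algebra K C]
      (b : C →ₗ[K] C →ₗ[K] C) (a : X → C),
      t.evalB (LinearMap.mul K C) b a = skewProd b (l.map a) := by
  match l with
  | [x, y] => exact ⟨.br (.leaf x) (.leaf y), rfl, fun _ _ _ _ _ => rfl⟩
  | [x, y, z] => exact ⟨.br (.br (.leaf x) (.leaf y)) (.leaf z), rfl, fun _ _ _ _ _ => rfl⟩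
  | x :: y :: z :: w :: l =>
    obtain ⟨t, ht, h⟩ := exists_tree_skewProd (z :: w :: l) (by simp)
    refine ⟨.dot (.br (.leaf x) (.leaf y)) t, by rw [OpTree.leaves, ht]; rfl,
      fun C _ _ b a => ?_⟩
    rw [OpTree.evalB_dot, h]
    rfl

/-- Normal forms of positive degree are values of trees. -/
theorem exists_tree_normalForm (l l' : List X) (hl : l'.length ≠ 1) (hne : l ++ l' ≠ []) :
    ∃ t : OpTree X, t.leaves = l ++ l' ∧ ∀ (C : Type u) [CommRing C] [Algebra K C]
      (b : C →ₗ[K] C →ₗ[K] C) (a : X → C),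
      t.evalB (LinearMap.mul K C) b a = normalForm b a l l' := by
  induction l with
  | nil =>
    obtain ⟨t, ht, h⟩ := exists_tree_skewProd K l' (by
      have := List.length_pos_of_ne_nil hne
      simp only [List.nil_append] at this
      omega)
    exact ⟨t, ht, fun C _ _ b a => by rw [h, normalForm, List.map_nil, List.prod_nil, one_mul]⟩
  | cons x l ih =>
    by_cases h0 : l ++ l' = []
    · obtain ⟨rfl, rfl⟩ := List.append_eq_nil_iff.1 h0
      exact ⟨.leaf x, rfl, fun C _ _ b a => by simp [normalForm, skewProd, OpTree.eval]⟩
    · obtain ⟨t, ht, h⟩ := ih h0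
      refine ⟨.dot (.leaf x) t, by rw [OpTree.leaves, ht]; rfl, fun C _ _ b a => ?_⟩
      rw [OpTree.evalB_dot, h]
      simp [normalForm, OpTree.eval, mul_assoc]

end Tree

end QgrAlt

/-! ### An algebra with independent normal forms -/

namespace QgrAlt

section Weight

open AddMonoidAlgebra

variable {R V : Type*} [CommRing R] [AddCommGroup V]

/-- The bracket on `R[V]` with `[u, v] = ω(u, v) · (u + v + e)` for `u, v ∈ V`. -/
noncomputable def weightBracket (ω : V →+ V →+ R) (e : V) :
    AddMonoidAlgebra R V →ₗ[R] AddMonoidAlgebra R V →ₗ[R] AddMonoidAlgebra R V :=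
  (Finsupp.linearCombination R fun u => (Finsupp.linearCombination R fun v =>
    (single (u + v + e) (ω u v) : AddMonoidAlgebra R V)) ∘ₗ
      (coeffLinearEquiv R).toLinearMap) ∘ₗ (coeffLinearEquiv R).toLinearMap

theorem weightBracket_single (ω : V →+ V →+ R) (e u v : V) (r s : R) :
    weightBracket ω e (single u r) (single v s) = single (u + v + e) (r * s * ω u v) := by
  simp [weightBracket, coeffLinearEquiv, mul_assoc]

variable (K : Type*) [Field K] [Algebra K R]

/-- The bracket `weightBracket` satisfies the relations if `ω` is alternating and products of two
of its values are totally skew-symmetric. -/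
theorem isAlgebra_weightBracket {ω : V →+ V →+ R} (h1 : ∀ u, ω u u = 0)
    (h2 : ∀ u v w, ω u v * ω u w = 0) (e : V) :
    IsAlgebra (LinearMap.mul K (AddMonoidAlgebra R V))
      ((weightBracket ω e).restrictScalars₁₂ K K) := by
  have skew : ∀ u v, ω u v = -ω v u := fun u v => by
    have h := h1 (u + v)
    simp only [map_add, AddMonoidHom.add_apply, h1, zero_add, add_zero] at h
    exact eq_neg_of_add_eq_zero_right h
  have h3 : ∀ u v w x, ω u v * ω w x = -(ω w v * ω u x) := fun u v w x => by
    have h := h2 (u + w) v x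
    simp only [map_add, AddMonoidHom.add_apply, add_mul, mul_add, h2, zero_add, add_zero] at h
    linear_combination h
  constructor
  · exact mul_comm
  · intro x y
    simp only [LinearMap.restrictScalars₁₂_apply_apply]
    induction x using AddMonoidAlgebra.induction_linear with
    | zero => simp
    | add x x' hx hx' => simp only [map_add, LinearMap.add_apply, hx, hx']; abel
    | single u r =>
      induction y using AddMonoidAlgebra.induction_linear with
      | zero => simp
      | add y y' hy hy' => simp only [map_add, LinearMap.add_apply, hy, hy']; abel
      | single v s =>
        rw [weightBracket_single, weightBracket_single, skew, add_comm u v, mul_comm r s, mul_neg,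
          single_neg]
  · intro x y z
    simp only [LinearMap.restrictScalars₁₂_apply_apply]
    induction x using AddMonoidAlgebra.induction_linear with
    | zero => simp
    | add x x' hx hx' => simp only [map_add, LinearMap.add_apply, hx, hx']; abel
    | single u r =>
      induction y using AddMonoidAlgebra.induction_linear with
      | zero => simp
      | add y y' hy hy' => simp only [map_add, LinearMap.add_apply, hy, hy']; abel
      | single v s =>
        induction z using AddMonoidAlgebra.induction_linear with
        | zero => simp
        | add z z' hz hz' => simp only [map_add, LinearMap.add_apply, hz, hz']; abel
        | single w t =>
          simp only [weightBracket_single]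
          rw [← single_neg]
          have hV : u + v + e + w + e = u + w + e + v + e := by abel
          rw [hV]
          congr 1
          simp only [map_add, AddMonoidHom.add_apply]
          have e1 := h2 u v w
          have e2 : ω v w * ω u v = 0 := by rw [skew u v, mul_neg, mul_comm, h2, neg_zero]
          have e3 : ω w v * ω u w = 0 := by rw [skew u w, mul_neg, mul_comm, h2, neg_zero]
          have e4 := h3 e w u v
          linear_combination (r * s * t) * (e1 + e1 + e2 + e3 + e4)
  · intro x y z
    simp only [LinearMap.restrictScalars₁₂_apply_apply, LinearMap.mul_apply']
    induction x using AddMonoidAlgebra.induction_linear with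
    | zero => simp
    | add x x' hx hx' => simp only [map_add, LinearMap.add_apply, add_mul, hx, hx']; abel
    | single u r =>
      induction y using AddMonoidAlgebra.induction_linear with
      | zero => simp
      | add y y' hy hy' => simp only [map_add, LinearMap.add_apply, mul_add, hy, hy']; abel
      | single v s =>
        induction z using AddMonoidAlgebra.induction_linear with
        | zero => simp
        | add z z' hz hz' => simp only [map_add, mul_add, add_mul, hz, hz']; abel
        | single w t =>
          simp only [weightBracket_single, single_mul_single]
          have hV1 : u + (v + w + e) = u + v + w + e := by abel
          have hV2 : u + w + e + v = u + v + w + e := by abel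
          rw [hV1, hV2, ← single_add]
          congr 1
          simp only [map_add, AddMonoidHom.add_apply]
          ring
  · exact mul_assoc

end Weight

end QgrAlt

/-! ### Exterior products as values of normal forms -/

namespace QgrAlt

section Exterior

variable (K : Type*) [Field K] {I : Type*} [DecidableEq I]

open ExteriorAlgebra

/-- The product in the exterior algebra of the basis vectors with indices in a list. -/
noncomputable def wedge (l : List I) : ExteriorAlgebra K (I → K) :=
  (l.map fun i => ι K (Pi.single i (1 : K))).prod

/-- The coefficient of `wedge q` in an element of the exterior algebra. -/
noncomputable def wedgeCoeff (q : List I) : ExteriorAlgebra K (I → K) →ₗ[K] K :=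
  liftAlternating (R := K) (Pi.single (M := fun d => (I → K) [⋀^Fin d]→ₗ[K] K) q.length
    (Matrix.detRowAlternating.compLinearMap
      (LinearMap.pi fun j : Fin q.length => LinearMap.proj (q.get j))))

theorem wedgeCoeff_wedge (q : List I) (v : Fin q.length → I) :
    wedgeCoeff K q (wedge K (List.ofFn v)) =
      Matrix.det fun r c => (Pi.single (v r) (1 : K) : I → K) (q.get c) := by
  have h : wedge K (List.ofFn v) = ιMulti K q.length fun r => Pi.single (v r) (1 : K) := by
    rw [wedge, ιMulti_apply, List.map_ofFn]; rfl
  rw [h, wedgeCoeff, liftAlternating_apply_ιMulti, Pi.single_eq_same]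
  rfl

theorem wedgeCoeff_of_length_ne {q l : List I} (h : l.length ≠ q.length) :
    wedgeCoeff K q (wedge K l) = 0 := by
  have h' : wedge K l = ιMulti K l.length fun r => Pi.single (l.get r) (1 : K) := by
    rw [wedge, ιMulti_apply]
    conv_lhs => rw [← List.ofFn_get l, List.map_ofFn]
    rfl
  rw [h', wedgeCoeff, liftAlternating_apply_ιMulti, Pi.single_eq_of_ne h]
  rfl

/-- Products of basis vectors with distinct sets of indices are linearly independent. -/
theorem linearIndependent_wedge {J : Type*} (L : J → List I) (hn : ∀ j, (L j).Nodup)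
    (hL : Pairwise fun i j => (L i).toFinset ≠ (L j).toFinset) :
    LinearIndependent K fun j => wedge K (L j) := by
  refine LinearIndependent.of_pairwise_dual_eq_zero_one _ (fun j => wedgeCoeff K (L j))
    (fun i j hij => ?_) fun j => ?_
  · by_cases hlen : (L j).length = (L i).length
    · obtain ⟨x, hx, hx'⟩ : ∃ x ∈ (L j).toFinset, x ∉ (L i).toFinset := by
        by_contra! hc
        refine hL hij (Finset.eq_of_subset_of_card_le hc ?_).symm
        rw [List.toFinset_card_of_nodup (hn _), List.toFinset_card_of_nodup (hn _), hlen]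
      obtain ⟨v, hv⟩ : ∃ v : Fin (L i).length → I, List.ofFn v = L j :=
        ⟨fun r => (L j).get (r.cast hlen.symm), List.ext_get (by simp [hlen]) (by simp)⟩
      rw [List.mem_toFinset] at hx hx'
      rw [← hv, List.mem_ofFn] at hx
      obtain ⟨r, rfl⟩ := hx
      rw [← hv, wedgeCoeff_wedge]
      refine Matrix.det_eq_zero_of_row_eq_zero r fun c => ?_
      refine Pi.single_eq_of_ne (fun h => hx' ?_) _
      rw [← h]
      exact List.get_mem _ _
    · exact wedgeCoeff_of_length_ne K hlen
  · have h := wedgeCoeff_wedge K (L j) (L j).get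
    rw [List.ofFn_get] at h
    have h1 : (Matrix.of fun r c => (Pi.single ((L j).get r) (1 : K) : I → K) ((L j).get c)) = 1 := by
      ext r c
      rw [Matrix.of_apply, Matrix.one_apply, Pi.single_apply]
      simp only [(List.nodup_iff_injective_get.1 (hn j)).eq_iff, eq_comm]
    exact h.trans ((congrArg Matrix.det h1).trans Matrix.det_one)

end Exterior

section Even

variable (K : Type*) [Field K] (V : Type*) [AddCommGroup V] [Module K V]

open ExteriorAlgebra

/-- The subalgebra of the exterior algebra generated by the products of two vectors. -/
abbrev EvenExterior : Type _ :=
  Algebra.adjoin K (Set.range fun p : V × V => ι K p.1 * ι K p.2)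

instance : IsMulCommutative (Algebra.adjoin K (Set.range fun p : V × V => ι K p.1 * ι K p.2)) := by
  refine Algebra.isMulCommutative_adjoin K ?_
  rintro _ ⟨⟨u, v⟩, rfl⟩ _ ⟨⟨w, x⟩, rfl⟩
  have sw : ∀ a b : V, ι K a * ι K b = -(ι K b * ι K a) := fun a b =>
    eq_neg_of_add_eq_zero_left (ι_add_mul_swap a b)
  calc ι K u * ι K v * (ι K w * ι K x) = ι K u * (ι K v * ι K w) * ι K x := by noncomm_ring
    _ = -((ι K u * ι K w) * (ι K v * ι K x)) := by rw [sw v w]; noncomm_ring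
    _ = -((ι K w * ι K u) * (ι K x * ι K v)) := by rw [sw u w, sw v x]; noncomm_ring
    _ = -(ι K w * (ι K u * ι K x) * ι K v) := by noncomm_ring
    _ = ι K w * ι K x * (ι K u * ι K v) := by rw [sw u x]; noncomm_ring

open scoped IsMulCommutative in
noncomputable instance : CommRing (EvenExterior K V) := inferInstance

/-- The product of two vectors, as an element of the even part of the exterior algebra. -/
noncomputable def wedgePair : V →+ V →+ EvenExterior K V :=
  AddMonoidHom.mk' (fun u => AddMonoidHom.mk'
    (fun v => ⟨ι K u * ι K v, Algebra.subset_adjoin ⟨(u, v), rfl⟩⟩)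
    fun v w => Subtype.ext (by simp [mul_add]))
    fun u v => AddMonoidHom.ext fun w => Subtype.ext (by simp [add_mul])

variable {V}

theorem coe_wedgePair (u v : V) :
    ((wedgePair K V u v : EvenExterior K V) : ExteriorAlgebra K V) = ι K u * ι K v := rfl

theorem wedgePair_swap (u v : V) : wedgePair K V u v = -wedgePair K V v u :=
  Subtype.ext (eq_neg_of_add_eq_zero_left (ι_add_mul_swap u v))

theorem wedgePair_self (u : V) : wedgePair K V u u = 0 :=
  Subtype.ext (ι_sq_zero u)

theorem wedgePair_mul_wedgePair (u v w : V) : wedgePair K V u v * wedgePair K V u w = 0 := by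
  refine Subtype.ext ?_
  have sw : ι K v * ι K u = -(ι K u * ι K v) := eq_neg_of_add_eq_zero_left (ι_add_mul_swap v u)
  calc ι K u * ι K v * (ι K u * ι K w) = ι K u * (ι K v * ι K u) * ι K w := by noncomm_ring
    _ = -((ι K u * ι K u) * ι K v * ι K w) := by rw [sw]; noncomm_ring
    _ = 0 := by rw [ι_sq_zero]; simp

end Even

section Model

universe u

/-- The indices of the basis vectors whose product is the value of `skewProd` on the list `l` of
generators of the model; the index `none` stands for the additional vector. -/
def skewIndices {X : Type} : List X → List (Option X)
  | [] => []
  | [x] => [some x]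
  | [x, y] => [some x, some y]
  | [x, y, z] => [none, some z, some x, some y]
  | x :: y :: z :: w :: l => some x :: some y :: skewIndices (z :: w :: l)

theorem skewIndices_perm {X : Type} (l : List X) :
    (skewIndices l).Perm (l.map some) ∨ (skewIndices l).Perm (none :: l.map some) := by
  match l with
  | [] => exact .inl .rfl
  | [x] => exact .inl .rfl
  | [x, y] => exact .inl .rfl
  | [x, y, z] =>
    exact .inr (.cons _ (List.perm_append_comm (l₁ := [some z]) (l₂ := [some x, some y])))
  | x :: y :: z :: w :: l =>
    rcases skewIndices_perm (z :: w :: l) with h | h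
    · exact .inl ((h.cons _).cons _)
    · refine .inr (((h.cons _).cons _).trans ?_)
      exact List.perm_middle (l₁ := [some x, some y])

theorem some_mem_skewIndices {X : Type} {l : List X} {x : X} :
    some x ∈ skewIndices l ↔ x ∈ l := by
  rcases skewIndices_perm l with h | h <;> simp [h.mem_iff]

theorem nodup_skewIndices {X : Type} {l : List X} (hl : l.Nodup) : (skewIndices l).Nodup := by
  have hl' := hl.map (Option.some_injective X)
  rcases skewIndices_perm l with h | h
  · exact h.nodup_iff.2 hl'
  · exact h.nodup_iff.2 (List.nodup_cons.2 ⟨by simp, hl'⟩)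

open AddMonoidAlgebra ExteriorAlgebra in
/-- There is an algebra in which the normal forms take the values `wedge` of pairwise different
lists. It consists of combinations of pairs of a weight and an element of the even part of an
exterior algebra on the generators and one more vector `e`; weights add up under the product, and
the bracket moreover multiplies by the two weights and adds `e` to the weight. -/
theorem exists_model (K : Type u) [Field K] (X : Type) [DecidableEq X] :
    ∃ (M : Type u) (_ : CommRing M) (_ : Algebra K M) (b : M →ₗ[K] M →ₗ[K] M) (a : X → M)
      (θ : M →ₗ[K] ExteriorAlgebra K (Option X → K)), IsAlgebra (LinearMap.mul K M) b ∧
        ∀ l l' : List X, l'.length ≠ 1 → θ (normalForm b a l l') = wedge K (skewIndices l') := by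
  let V := Option X → K
  let R := EvenExterior K V
  let e : Option X → V := fun i => Pi.single i 1
  let b := (weightBracket (wedgePair K V) (e none)).restrictScalars₁₂ K K
  let a : X → AddMonoidAlgebra R V := fun x => single (e (some x)) 1
  have hb : ∀ u v (r s : R), b (single u r) (single v s) =
      single (u + v + e none) (r * s * wedgePair K V u v) :=
    weightBracket_single _ _
  let ε : AddMonoidAlgebra R V →ₐ[R] R := AddMonoidAlgebra.lift R R V 1
  refine ⟨AddMonoidAlgebra R V, inferInstance, inferInstance, b, a,
    (Algebra.adjoin K (Set.range fun p : V × V => ι K p.1 * ι K p.2)).val.toLinearMap ∘ₗ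
      ε.toLinearMap.restrictScalars K,
    isAlgebra_weightBracket K (wedgePair_self K) (wedgePair_mul_wedgePair K) (e none), ?_⟩
  have hprod : ∀ l : List X, ∃ d, (l.map a).prod = single d 1 := by
    intro l
    induction l with
    | nil => exact ⟨0, rfl⟩
    | cons x l ih =>
      obtain ⟨d, hd⟩ := ih
      exact ⟨e (some x) + d, by rw [List.map_cons, List.prod_cons, hd, single_mul_single, mul_one]⟩
  have hskew : ∀ l : List X, l.length ≠ 1 → ∃ (d : V) (r : R),
      skewProd b (l.map a) = single d r ∧ (r : ExteriorAlgebra K V) = wedge K (skewIndices l) := by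
    intro l
    induction l using skewIndices.induct with
    | case1 => exact fun _ => ⟨0, 1, rfl, rfl⟩
    | case2 x => exact fun h => absurd rfl h
    | case3 x y =>
      refine fun _ => ⟨_, _, hb _ _ _ _, ?_⟩
      simp [coe_wedgePair, skewIndices, wedge, e]
    | case4 x y z =>
      refine fun _ => ⟨_, _, (congrArg (fun p => b p _) (hb _ _ _ _)).trans (hb _ _ _ _), ?_⟩
      have h : wedgePair K V (e (some x)) (e (some y)) *
          wedgePair K V (e (some x) + e (some y) + e none) (e (some z)) =
          wedgePair K V (e none) (e (some z)) * wedgePair K V (e (some x)) (e (some y)) := by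
        have h' := wedgePair_mul_wedgePair K (e (some y)) (e (some x)) (e (some z))
        rw [wedgePair_swap, neg_mul, neg_eq_zero] at h'
        rw [map_add, map_add, AddMonoidHom.add_apply, AddMonoidHom.add_apply, mul_add, mul_add,
          wedgePair_mul_wedgePair, h', zero_add, zero_add, mul_comm]
      rw [one_mul, one_mul, mul_one, h]
      simp [coe_wedgePair, skewIndices, wedge, e, mul_assoc]
    | case5 x y z w l ih =>
      intro _
      obtain ⟨d, r, h1, h3⟩ := ih (by simp)
      refine ⟨_, _, (congrArg (b (a x) (a y) * ·) h1).trans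
        ((congrArg (· * single d r) (hb _ _ _ _)).trans (single_mul_single _ _ _ _)), ?_⟩
      rw [one_mul, one_mul]
      refine (congrArg₂ (· * ·) (coe_wedgePair K _ _) h3).trans ?_
      simp [skewIndices, wedge, e, mul_assoc]
  intro l l' hl
  obtain ⟨d, hd⟩ := hprod l
  obtain ⟨d', r, h1, h3⟩ := hskew l' hl
  rw [normalForm, hd, h1, single_mul_single, one_mul, ← h3]
  simp [ε]

end Model

end QgrAlt

/-! ### Normal forms in the operad -/

namespace QgrAlt

universe u

/-- The lists `l` and `l'` are the two parts of a partition of the arguments, and `l'` does not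
consist of one argument. -/
structure IsNormal {n : ℕ} (l l' : List (Fin n)) : Prop where
  perm : (l ++ l').Perm (List.finRange n)
  length_ne : l'.length ≠ 1

section

variable {K : Type*} [Field K] {n : ℕ}

theorem treeClass_of_perm {t : OpTree (Fin n)} (ht : t.leaves.Perm (List.finRange n)) :
    ∃ h, treeClass (K := K) t = (ideal K n).mkQ (mon K t h) := by
  have h : t.leaves.Nodup ∧ ∀ i, i ∈ t.leaves :=
    ⟨ht.nodup_iff.2 (List.nodup_finRange n), fun i => ht.mem_iff.2 (List.mem_finRange i)⟩
  exact ⟨h, dif_pos h⟩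

theorem rep_treeClass {t : OpTree (Fin n)} (ht : t.leaves.Perm (List.finRange n))
    (σ : Equiv.Perm (Fin n)) : rep K n σ (treeClass t) = treeClass (t.relabel σ) := by
  obtain ⟨h, e⟩ := treeClass_of_perm (K := K) ht
  have h' : (t.relabel σ).leaves.Nodup ∧ ∀ i, i ∈ (t.relabel σ).leaves :=
    (TreeMonomial.perm σ ⟨t, h⟩).2
  rw [e, treeClass, dif_pos h']
  change (ideal K n).mkQ (FreeOperad.permRep K n σ (mon K t h)) = _
  congr 1
  exact Finsupp.mapDomain_single

theorem evalComponent_treeClass {A : Type*} [AddCommGroup A] [Module K A]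
    {m b : A →ₗ[K] A →ₗ[K] A} (hA : IsAlgebra m b) (a : Fin n → A) {t : OpTree (Fin n)}
    (ht : t.leaves.Perm (List.finRange n)) :
    hA.evalComponent a (treeClass t) = t.evalB m b a := by
  obtain ⟨h, e⟩ := treeClass_of_perm (K := K) ht
  rw [e, ← evalAt_mon t h a]
  rfl

theorem span_treeClass : Submodule.span K
    {x : Component K n | ∃ t : OpTree (Fin n), t.leaves.Perm (List.finRange n) ∧
      x = treeClass t} = ⊤ := by
  refine eq_top_iff.2 fun x _ => ?_
  obtain ⟨f, rfl⟩ := (ideal K n).mkQ_surjective x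
  induction f using Finsupp.induction_linear with
  | zero => rw [map_zero]; exact zero_mem _
  | add f g hf hg => rw [map_add]; exact add_mem (hf trivial) (hg trivial)
  | single t c =>
    have h : (ideal K n).mkQ (Finsupp.single t c) = c • treeClass t.1 := by
      rw [treeClass, dif_pos t.2, ← map_smul]
      congr 1
      exact ((Finsupp.smul_single c t 1).trans (by rw [smul_eq_mul, mul_one])).symm
    rw [h]
    refine Submodule.smul_mem _ _ (Submodule.subset_span ⟨t.1, ?_, rfl⟩)
    exact (List.perm_ext_iff_of_nodup t.2.1 (List.nodup_finRange n)).2 fun i =>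
      ⟨fun _ => List.mem_finRange i, fun _ => t.2.2 i⟩

end

/-- Normal forms in the operad: `N l l'` is the product of the arguments in `l` and of the
skew-symmetric element on the arguments in `l'`. They span, by the computation in the unitization of
the free algebra, and the model supplies the map `θ` that detects their independence. -/
theorem exists_normalForm_component (K : Type u) [Field K] (h2 : (2 : K) ≠ 0) {n : ℕ}
    (hn : 1 ≤ n) : ∃ N : List (Fin n) → List (Fin n) → Component K n,
      (∀ l l', IsNormal l l' → ∀ σ : Equiv.Perm (Fin n),
        rep K n σ (N l l') = N (l.map σ) (l'.map σ)) ∧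
      (∀ l₁ l₂ l', l₁.Perm l₂ → N l₁ l' = N l₂ l') ∧
      (∀ l (m : ℕ) (v : Fin m → Fin n) (σ : Equiv.Perm (Fin m)), N l (List.ofFn (v ∘ σ)) =
        ((Equiv.Perm.sign σ : ℤˣ) : ℤ) • N l (List.ofFn v)) ∧
      (Submodule.span K {x | ∃ l l', IsNormal l l' ∧ x = N l l'} = ⊤) ∧
      ∃ θ : Component K n →ₗ[K] ExteriorAlgebra K (Option (Fin n) → K),
        ∀ l l', IsNormal l l' → θ (N l l') = wedge K (skewIndices l') := by
  obtain ⟨C, _, _, b, i, p, hC, hpi, hm, hb⟩ :=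
    (FreeAlg.isAlgebra (K := K) (X := Fin n)).exists_unital
  let a : Fin n → C := i ∘ FreeAlg.gen
  let P : C →ₗ[K] Component K n := FreeAlg.toComponent n ∘ₗ p
  have hP : ∀ t : OpTree (Fin n), P (t.evalB (LinearMap.mul K C) b a) = treeClass t := by
    intro t
    have h := OpTree.map_eval (m' := fun x y => LinearMap.mul K C x y) (b' := fun x y => b x y)
      i hm hb FreeAlg.gen t
    rw [← FreeAlg.toComponent_evalB]
    change FreeAlg.toComponent n (p (OpTree.eval _ _ (i ∘ FreeAlg.gen) t)) = _
    rw [← h, hpi]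
  -- as values of trees, normal forms can be permuted and evaluated in other algebras
  have tree : ∀ l l' : List (Fin n), IsNormal l l' → ∃ t : OpTree (Fin n),
      t.leaves.Perm (List.finRange n) ∧ ∀ (C : Type u) [CommRing C] [Algebra K C]
        (b : C →ₗ[K] C →ₗ[K] C) (a : Fin n → C),
        t.evalB (LinearMap.mul K C) b a = normalForm b a l l' := by
    intro l l' h
    obtain ⟨t, ht, h'⟩ := exists_tree_normalForm K l l' h.length_ne (by
      intro h0
      have := h.perm.length_eq
      rw [h0, List.length_finRange, List.length_nil] at this
      omega)
    exact ⟨t, ht ▸ h.perm, h'⟩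
  refine ⟨fun l l' => P (normalForm b a l l'), ?_, ?_, ?_, ?_, ?_⟩
  · intro l l' h σ
    obtain ⟨t, ht, h'⟩ := tree l l' h
    simp only
    rw [← h', hP, rep_treeClass ht, ← hP]
    congr 1
    refine (OpTree.eval_relabel _ _ a σ t).trans ((h' C b (a ∘ σ)).trans ?_)
    rw [normalForm, normalForm, List.map_map, List.map_map]
  · intro l₁ l₂ l' h
    simp only [normalForm]
    rw [(h.map a).prod_eq]
  · intro l m v σ
    simp only [normalForm, List.map_ofFn]
    rw [← Function.comp_assoc, hC.skewProd_ofFn_perm h2, mul_smul_comm, map_zsmul]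
  · refine eq_top_iff.2 ?_
    rw [← span_treeClass, Submodule.span_le]
    rintro _ ⟨t, ht, rfl⟩
    rw [← hP]
    have h := Submodule.mem_map_of_mem (f := P) (hC.evalB_mem_span_normalForm h2 (a := a) t)
    rw [Submodule.map_span] at h
    refine Submodule.span_mono ?_ h
    rintro _ ⟨_, ⟨l, l', h1, h3, rfl⟩, rfl⟩
    exact ⟨l, l', ⟨h1.trans ht, h3⟩, rfl⟩
  · obtain ⟨M, _, _, bM, aM, θ, hM, hθ⟩ := exists_model K (Fin n)
    refine ⟨θ ∘ₗ hM.evalComponent aM, fun l l' h => ?_⟩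
    obtain ⟨t, ht, h'⟩ := tree l l' h
    simp only
    rw [← h', hP, LinearMap.comp_apply, evalComponent_treeClass hM aM ht, h', hθ l l' h.length_ne]

end QgrAlt

/-! ### Induced modules -/

section Induced

namespace Representation

variable {k G H A B : Type*} [CommRing k] [Group G] [Group H] (φ : G →* H)
  [AddCommGroup A] [Module k A] (ρ : Representation k G A)
  [AddCommGroup B] [Module k B] (τ : Representation k H B)

/-- Frobenius reciprocity: the linear map on the induced module that extends an equivariant map
`f` on `A`. -/
noncomputable def indLift (f : A →ₗ[k] B) (hf : ∀ g, f ∘ₗ ρ g = τ (φ g) ∘ₗ f) :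
    IndV φ ρ →ₗ[k] B :=
  Coinvariants.lift _ (TensorProduct.lift <| (Finsupp.lift _ _ _ fun h => τ h⁻¹ ∘ₗ f) ∘ₗ
      (MonoidAlgebra.coeffLinearEquiv k).toLinearMap) fun g => by
    ext h x
    have h' := LinearMap.congr_fun (hf g) x
    simp only [LinearMap.comp_apply] at h'
    simp only [LinearMap.coe_comp, Function.comp_apply, MonoidAlgebra.lsingle_apply]
    simp [ofMulAction_single, mul_inv_rev, h']

theorem indLift_mk (f : A →ₗ[k] B) (hf : ∀ g, f ∘ₗ ρ g = τ (φ g) ∘ₗ f) (h : H) (a : A) :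
    indLift φ ρ τ f hf (IndV.mk φ ρ h a) = τ h⁻¹ (f a) := by
  simp [indLift]

theorem indLift_ind (f : A →ₗ[k] B) (hf : ∀ g, f ∘ₗ ρ g = τ (φ g) ∘ₗ f) (h : H)
    (x : IndV φ ρ) : indLift φ ρ τ f hf (ind φ ρ h x) = τ h (indLift φ ρ τ f hf x) := by
  refine LinearMap.congr_fun (f := indLift φ ρ τ f hf ∘ₗ ind φ ρ h)
    (g := τ h ∘ₗ indLift φ ρ τ f hf) (IndV.hom_ext _ _ fun h' => LinearMap.ext fun a => ?_) x
  change indLift φ ρ τ f hf (ind φ ρ h (IndV.mk φ ρ h' a)) =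
    τ h (indLift φ ρ τ f hf (IndV.mk φ ρ h' a))
  rw [ind_mk, indLift_mk, indLift_mk, mul_inv_rev,
    inv_inv, map_mul, Module.End.mul_apply]

theorem IndV.mk_mul (g : G) (h : H) (a : A) :
    IndV.mk φ ρ (φ g * h) (ρ g a) = IndV.mk φ ρ h a := by
  have := Coinvariants.mk_self_apply (tprod ((leftRegular k H).comp φ) ρ) g
    (MonoidAlgebra.single h 1 ⊗ₜ a)
  simpa [ofMulAction_single] using this

end Representation

end Induced

/-! ### Permutations of blocks of arguments -/

namespace QgrAlt

section Blocks

variable {n k : ℕ}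

/-- The arguments with index at least `k` are numbered by `Fin (n - k)`. -/
def upperEquiv (n k : ℕ) : {i : Fin n // ¬ (i : ℕ) < k} ≃ Fin (n - k) where
  toFun i := ⟨i.1 - k, by have := i.2; have := i.1.2; omega⟩
  invFun j := ⟨⟨k + j, by have := j.2; omega⟩, by simp⟩
  left_inv i := by
    have := i.2
    ext
    simp only
    omega
  right_inv j := by ext; simp

theorem drop_finRange (n k : ℕ) :
    (List.finRange n).drop k = List.ofFn fun j => ((upperEquiv n k).symm j : Fin n) := by
  refine List.ext_getElem (by simp) fun i _ _ => ?_
  simp [upperEquiv]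

theorem mem_take_finRange {i : Fin n} : i ∈ (List.finRange n).take k ↔ (i : ℕ) < k := by
  rw [List.mem_take_iff_getElem]
  constructor
  · rintro ⟨j, hj, rfl⟩
    simp only [List.length_finRange] at hj
    simp only [List.getElem_finRange, Fin.val_cast]
    omega
  · intro h
    exact ⟨i, by simpa using h, by simp⟩

theorem mem_drop_finRange {i : Fin n} : i ∈ (List.finRange n).drop k ↔ ¬ (i : ℕ) < k := by
  rw [drop_finRange, List.mem_ofFn]
  constructor
  · rintro ⟨j, rfl⟩
    exact ((upperEquiv n k).symm j).2
  · intro h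
    exact ⟨upperEquiv n k ⟨i, h⟩, by simp⟩

theorem isNormal_blocks (hk : k + 2 ≤ n ∨ k = n) (σ : Equiv.Perm (Fin n)) :
    IsNormal (((List.finRange n).take k).map σ) (((List.finRange n).drop k).map σ) where
  perm := by
    rw [← List.map_append, List.take_append_drop]
    exact (List.perm_ext_iff_of_nodup ((List.nodup_finRange n).map σ.injective)
      (List.nodup_finRange n)).2 fun i => by simpa using σ.surjective i
  length_ne := by
    rw [List.length_map, List.length_drop, List.length_finRange]
    omega

/-- Every normal form is obtained from a standard one by a permutation of the arguments. -/
theorem IsNormal.exists_perm {l l' : List (Fin n)} (h : IsNormal l l') :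
    ∃ σ : Equiv.Perm (Fin n), ((List.finRange n).take l.length).map σ = l ∧
      ((List.finRange n).drop l.length).map σ = l' := by
  have hlen : (l ++ l').length = n := by rw [h.perm.length_eq, List.length_finRange]
  have hnd : (l ++ l').Nodup := h.perm.nodup_iff.2 (List.nodup_finRange n)
  let f : Fin n → Fin n := fun i => (l ++ l').get (i.cast hlen.symm)
  have hf : Function.Injective f := fun i j hij => by
    simpa using (List.nodup_iff_injective_get.1 hnd) hij
  let σ : Equiv.Perm (Fin n) := Equiv.ofBijective f (Finite.injective_iff_bijective.1 hf)
  have hσ : (List.finRange n).map σ = l ++ l' :=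
    List.ext_getElem (by simpa using hlen.symm) fun i _ _ => by simp [σ, f]
  rw [← List.take_append_drop l.length (List.finRange n), List.map_append] at hσ
  refine ⟨σ, List.append_inj hσ ?_⟩
  have : l.length ≤ n := by rw [List.length_append] at hlen; omega
  simpa using this

end Blocks

section Sign

variable {K : Type*} [Field K] {B : Type*} [AddCommGroup B] [Module K B] {n : ℕ}

/-- A skew-symmetric family of normal forms spans a copy of `1_k ⊗ sgn_{n-k}`. -/
theorem rep_blocks {τ : Representation K (Equiv.Perm (Fin n)) B}
    {N : List (Fin n) → List (Fin n) → B}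
    (h1 : ∀ l l', IsNormal l l' → ∀ σ : Equiv.Perm (Fin n), τ σ (N l l') = N (l.map σ) (l'.map σ))
    (h2 : ∀ l₁ l₂ l', l₁.Perm l₂ → N l₁ l' = N l₂ l')
    (h3 : ∀ l (m : ℕ) (v : Fin m → Fin n) (σ : Equiv.Perm (Fin m)), N l (List.ofFn (v ∘ σ)) =
      ((Equiv.Perm.sign σ : ℤˣ) : ℤ) • N l (List.ofFn v))
    {k : ℕ} (hk : k + 2 ≤ n ∨ k = n)
    (g : Equiv.Perm {i : Fin n // (i : ℕ) < k} × Equiv.Perm {i : Fin n // ¬ (i : ℕ) < k}) :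
    LinearMap.toSpanSingleton K B
        (N ((List.finRange n).take k) ((List.finRange n).drop k)) ∘ₗ trivTensorSgn K n k g =
      τ (Equiv.Perm.subtypeCongrHom (fun i : Fin n => (i : ℕ) < k) g) ∘ₗ
        LinearMap.toSpanSingleton K B
          (N ((List.finRange n).take k) ((List.finRange n).drop k)) := by
  obtain ⟨σ, ρ⟩ := g
  have hN : IsNormal ((List.finRange n).take k) ((List.finRange n).drop k) := by
    have h := isNormal_blocks hk 1
    rwa [Equiv.Perm.coe_one, List.map_id, List.map_id] at h
  have hp : ∀ i : Fin n, ((σ.subtypeCongr ρ i : Fin n) : ℕ) < k ↔ (i : ℕ) < k := by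
    intro i
    by_cases hi : (i : ℕ) < k
    · rw [Equiv.Perm.subtypeCongr.left_apply (p := fun i : Fin n => (i : ℕ) < k) _ _ hi]
      exact ⟨fun _ => hi, fun _ => (σ _).2⟩
    · rw [Equiv.Perm.subtypeCongr.right_apply (p := fun i : Fin n => (i : ℕ) < k) _ _ hi]
      exact ⟨fun h => absurd h (ρ _).2, fun h => absurd h hi⟩
  have hnd : ((List.finRange n).take k).Nodup :=
    (List.nodup_finRange n).sublist (List.take_sublist _ _)
  have hl : (((List.finRange n).take k).map (σ.subtypeCongr ρ)).Perm ((List.finRange n).take k) := by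
    refine (List.perm_ext_iff_of_nodup
      (hnd.map (Equiv.injective _)) hnd).2
      fun i => ?_
    rw [List.mem_map, mem_take_finRange]
    constructor
    · rintro ⟨j, hj, rfl⟩
      exact (hp j).2 (mem_take_finRange.1 hj)
    · intro hi
      refine ⟨(σ.subtypeCongr ρ).symm i, mem_take_finRange.2 ((hp _).1 ?_),
        Equiv.apply_symm_apply _ _⟩
      rwa [Equiv.apply_symm_apply]
  have hr : ((List.finRange n).drop k).map (σ.subtypeCongr ρ) =
      List.ofFn ((fun j => ((upperEquiv n k).symm j : Fin n)) ∘
        (((upperEquiv n k).symm.trans ρ).trans (upperEquiv n k))) := by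
    rw [drop_finRange, List.map_ofFn]
    congr 1
    funext j
    simp
  refine LinearMap.ext_ring ?_
  simp only [LinearMap.comp_apply, LinearMap.toSpanSingleton_apply, one_smul]
  change _ = τ (σ.subtypeCongr ρ) _
  rw [h1 _ _ hN, h2 _ _ _ hl, hr, h3, Equiv.Perm.sign_symm_trans_trans, ← drop_finRange]
  change ((((Equiv.Perm.sign ρ : ℤˣ) : ℤ) : K) * 1) • _ = _
  rw [mul_one, Int.cast_smul_eq_zsmul]

/-- The generators of the induced module that correspond to permutations with the same image of
the last block differ by a sign. -/
theorem indV_mk_of_image {k : ℕ} {g h : Equiv.Perm (Fin n)}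
    (hgh : ∀ i, ((g i : Fin n) : ℕ) < k ↔ ((h i : Fin n) : ℕ) < k) :
    Representation.IndV.mk (Equiv.Perm.subtypeCongrHom fun i : Fin n => (i : ℕ) < k)
        (trivTensorSgn K n k) h 1 ∈
      Submodule.span K {Representation.IndV.mk
        (Equiv.Perm.subtypeCongrHom fun i : Fin n => (i : ℕ) < k) (trivTensorSgn K n k) g 1} := by
  have hp : ∀ i, (((h * g⁻¹) i : Fin n) : ℕ) < k ↔ (i : ℕ) < k := fun i => by
    rw [Equiv.Perm.mul_apply, ← hgh, ← Equiv.Perm.mul_apply, mul_inv_cancel, Equiv.Perm.one_apply]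
  let c : Equiv.Perm {i : Fin n // (i : ℕ) < k} × Equiv.Perm {i : Fin n // ¬ (i : ℕ) < k} :=
    ((h * g⁻¹).subtypePerm hp, (h * g⁻¹).subtypePerm fun i => not_congr (hp i))
  have hc : Equiv.Perm.subtypeCongrHom (fun i : Fin n => (i : ℕ) < k) c * g = h := by
    have : Equiv.Perm.subtypeCongrHom (fun i : Fin n => (i : ℕ) < k) c = h * g⁻¹ := by
      refine Equiv.ext fun i => ?_
      change Equiv.Perm.subtypeCongr _ _ i = _
      by_cases hi : (i : ℕ) < k
      · rw [Equiv.Perm.subtypeCongr.left_apply (p := fun i : Fin n => (i : ℕ) < k) _ _ hi]; rfl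
      · rw [Equiv.Perm.subtypeCongr.right_apply (p := fun i : Fin n => (i : ℕ) < k) _ _ hi]; rfl
    rw [this, inv_mul_cancel_right]
  have hs : ∃ s : K, trivTensorSgn K n k c s = 1 := by
    refine ⟨(((Equiv.Perm.sign c.2 : ℤˣ) : ℤ) : K), ?_⟩
    change (((Equiv.Perm.sign c.2 : ℤˣ) : ℤ) : K) * (((Equiv.Perm.sign c.2 : ℤˣ) : ℤ) : K) = 1
    rw [← Int.cast_mul, ← Units.val_mul, Int.units_mul_self, Units.val_one, Int.cast_one]
  obtain ⟨s, hs⟩ := hs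
  have key := Representation.IndV.mk_mul
    (Equiv.Perm.subtypeCongrHom fun i : Fin n => (i : ℕ) < k) (trivTensorSgn K n k) c g s
  rw [hc, hs] at key
  rw [key, Submodule.mem_span_singleton]
  exact ⟨s, by rw [← map_smul, smul_eq_mul, mul_one]⟩

end Sign

end QgrAlt

/-! ### Decomposition of the operad -/

namespace QgrAlt

/-- A permutation that maps the arguments with index at least `k` onto a given set. -/
theorem exists_perm_image {n k : ℕ} (S : Finset (Fin n)) (hS : S.card = n - k) :
    ∃ g : Equiv.Perm (Fin n), ∀ i, g i ∈ S ↔ ¬ (i : ℕ) < k := by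
  let e : {i : Fin n // ¬ (i : ℕ) < k} ≃ {i // i ∈ S} :=
    (upperEquiv n k).trans (S.equivFinOfCardEq hS).symm
  refine ⟨e.extendSubtype, fun i => ⟨fun h hi => ?_, fun hi => e.extendSubtype_mem i hi⟩⟩
  exact e.extendSubtype_not_mem i (not_not.2 hi) h

theorem card_image_upper {n k : ℕ} (h : Equiv.Perm (Fin n)) :
    (Finset.univ.filter fun i => ¬ ((h i : Fin n) : ℕ) < k).card = n - k :=
  Finset.card_eq_of_equiv_fin
    ((h.subtypeEquiv fun i => by simp).trans (upperEquiv n k))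

end QgrAlt

theorem mainTheorem3 (K : Type*) [Field K] (hK : ringChar K ≠ 2) (n : ℕ) (hn : 1 ≤ n) :
    Nonempty (Representation.Equiv (QgrAlt.rep K n)
      (Representation.directSum
        fun k : {k : ℕ // k + 2 ≤ n ∨ k = n} => indTrivSgn K n k)) := by
  classical
  obtain ⟨N, h1, h2, h3, hspan, θ, hθ⟩ :=
    QgrAlt.exists_normalForm_component K (Ring.two_ne_zero hK) hn
  let φ : ∀ k : {k : ℕ // k + 2 ≤ n ∨ k = n}, _ := fun k =>
    Equiv.Perm.subtypeCongrHom fun i : Fin n => (i : ℕ) < k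
  let V : {k : ℕ // k + 2 ≤ n ∨ k = n} → Type _ := fun k =>
    Representation.IndV (φ k) (trivTensorSgn K n k)
  let mk : ∀ k, Equiv.Perm (Fin n) → K →ₗ[K] V k := fun k =>
    Representation.IndV.mk (φ k) (trivTensorSgn K n k)
  -- the normal form whose skew arguments are `k, …, n - 1`
  let x : ℕ → QgrAlt.Component K n := fun k =>
    N ((List.finRange n).take k) ((List.finRange n).drop k)
  let ψ : ∀ k, V k →ₗ[K] QgrAlt.Component K n := fun k =>
    Representation.indLift (φ k) (trivTensorSgn K n k) (QgrAlt.rep K n)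
      (LinearMap.toSpanSingleton K _ (x k)) fun g => QgrAlt.rep_blocks h1 h2 h3 k.2 g
  let Ψ : (DirectSum _ V) →ₗ[K] QgrAlt.Component K n := DirectSum.toModule K _ _ ψ
  have hΨ : ∀ k z, Ψ (DirectSum.lof K _ V k z) = ψ k z := fun k z =>
    DirectSum.toModule_lof K k z
  have hx : ∀ (k : {k : ℕ // k + 2 ≤ n ∨ k = n}) (σ : Equiv.Perm (Fin n)),
      Ψ (DirectSum.lof K _ V k (mk k σ⁻¹ 1)) =
        N (((List.finRange n).take k).map σ) (((List.finRange n).drop k).map σ) := by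
    intro k σ
    have hN := QgrAlt.isNormal_blocks k.2 1
    rw [Equiv.Perm.coe_one, List.map_id, List.map_id] at hN
    rw [hΨ, ← h1 _ _ hN]
    refine (Representation.indLift_mk _ _ _ _ _ _ _).trans ?_
    rw [inv_inv, LinearMap.toSpanSingleton_apply, one_smul]
  have hequiv : ∀ g, Ψ ∘ₗ Representation.directSum
      (fun k : {k : ℕ // k + 2 ≤ n ∨ k = n} => indTrivSgn K n k) g =
      QgrAlt.rep K n g ∘ₗ Ψ := by
    intro g
    refine DirectSum.linearMap_ext K fun k => LinearMap.ext fun z => ?_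
    have h : DirectSum.lmap (fun k : {k : ℕ // k + 2 ≤ n ∨ k = n} => indTrivSgn K n k g)
        (DirectSum.lof K _ V k z) = DirectSum.lof K _ V k (indTrivSgn K n k g z) :=
      DirectSum.lmap_lof _ _ _
    simp only [LinearMap.comp_apply, Representation.directSum_apply]
    rw [h, hΨ, hΨ]
    exact Representation.indLift_ind _ _ _ _ _ g z
  have hsurj : Function.Surjective Ψ := by
    rw [← LinearMap.range_eq_top, eq_top_iff, ← hspan, Submodule.span_le]
    rintro _ ⟨l, l', h, rfl⟩
    obtain ⟨σ, e1, e2⟩ := h.exists_perm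
    have hlen := h.perm.length_eq
    rw [List.length_append, List.length_finRange] at hlen
    have := h.length_ne
    refine ⟨_, (hx ⟨l.length, by omega⟩ σ).trans ?_⟩
    simp only [e1, e2]
  have hinj : Function.Injective Ψ := by
    -- `J` indexes a spanning set of the direct sum: one vector for each image of the last block
    let J := Σ k : {k : ℕ // k + 2 ≤ n ∨ k = n}, {S : Finset (Fin n) // S.card = n - k}
    choose g hg using fun j : J => QgrAlt.exists_perm_image j.2.1 j.2.2
    let y : J → DirectSum _ V := fun j => DirectSum.lof K _ V j.1 (mk j.1 (g j)⁻¹ 1)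
    have hmem : ∀ (j : J) (i : Fin n), i ∈ ((List.finRange n).drop j.1).map (g j) ↔ i ∈ j.2.1 := by
      intro j i
      rw [List.mem_map]
      constructor
      · rintro ⟨i, hi, rfl⟩
        exact (hg j i).2 (QgrAlt.mem_drop_finRange.1 hi)
      · intro hi
        obtain ⟨i, rfl⟩ := (g j).surjective i
        exact ⟨i, QgrAlt.mem_drop_finRange.2 ((hg j i).1 hi), rfl⟩
    have hli : LinearIndependent K (Ψ ∘ y) := by
      refine LinearIndependent.of_comp θ ?_
      have e : (θ ∘ Ψ ∘ y) = fun j => QgrAlt.wedge K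
          (QgrAlt.skewIndices (((List.finRange n).drop j.1).map (g j))) := by
        funext j
        simp only [Function.comp_apply, y]
        rw [hx, hθ _ _ (QgrAlt.isNormal_blocks j.1.2 _)]
      rw [e]
      refine QgrAlt.linearIndependent_wedge K _ (fun j => QgrAlt.nodup_skewIndices
        (((List.nodup_finRange n).sublist (List.drop_sublist _ _)).map (g j).injective)) ?_
      rintro ⟨k, S, hS⟩ ⟨k', S', hS'⟩ hne heq
      refine hne ?_
      obtain rfl : S = S' := by
        ext i
        rw [← hmem ⟨k, S, hS⟩ i, ← hmem ⟨k', S', hS'⟩ i, ← QgrAlt.some_mem_skewIndices,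
          ← QgrAlt.some_mem_skewIndices (l := List.map (g ⟨k', S', hS'⟩) _), ← List.mem_toFinset,
          heq, List.mem_toFinset]
      obtain rfl : k = k' := by
        have := k.2
        have := k'.2
        ext
        omega
      rfl
    have hy : Submodule.span K (Set.range y) = ⊤ := by
      rw [← Submodule.ker_mkQ (Submodule.span K (Set.range y)), LinearMap.ker_eq_top]
      refine DirectSum.linearMap_ext K fun k => Representation.IndV.hom_ext _ _ fun h =>
        LinearMap.ext_ring ?_
      refine (Submodule.Quotient.mk_eq_zero _).2 ?_
      let j : J := ⟨k, _, QgrAlt.card_image_upper (k := k) h⟩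
      have hj := QgrAlt.indV_mk_of_image (K := K) (k := k) (g := (g j)⁻¹) (h := h) fun i => by
        have hi := hg j ((g j)⁻¹ i)
        rw [← Equiv.Perm.mul_apply, mul_inv_cancel, Equiv.Perm.one_apply] at hi
        rw [← not_iff_not, ← hi]
        simp [j]
      obtain ⟨c, hc⟩ := Submodule.mem_span_singleton.1 hj
      change DirectSum.lof K _ V k (mk k h 1) ∈ _
      have hc' : c • mk k (g j)⁻¹ 1 = mk k h 1 := hc
      rw [← hc', map_smul]
      exact Submodule.smul_mem _ _ (Submodule.subset_span ⟨j, rfl⟩)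
    refine (injective_iff_map_eq_zero Ψ).2 fun z hz => ?_
    obtain ⟨c, rfl⟩ := (Finsupp.mem_span_range_iff_exists_finsupp (R := K)).1
      (hy.ge (Submodule.mem_top (x := z)))
    rw [map_finsuppSum] at hz
    simp only [map_smul] at hz
    rw [linearIndependent_iff.1 hli c hz, Finsupp.sum_zero_index]
  exact ⟨(Representation.Equiv.mk (LinearEquiv.ofBijective Ψ ⟨hinj, hsurj⟩) hequiv).symm⟩
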